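/- **Setting.** Fix $\kappa=1/10$. Let $n,T\ge 0$ and $\ell\ge 1$ be integers, and consider bosons in $2^n$ modes indexed by $\{0,1\}^n$, with position annihilation and creation operators $\hat a_x,\hat a_x^\dagger$ acting on the Fock basis in the usual way, and momentum operators $\tilde a_y=2^{-n/2}\sum_x(-1)^{x\cdot y}\hat a_x$, $\tilde a_y^\dagger=2^{-n/2}\sum_x(-1)^{x\cdot y}\hat a_x^\dagger$. On the space $\mathsf S$ of exactly $\ell$ bosons let $$\tilde G_y=\frac1{\sqrt\ell}\sum_{x\in\{0,1\}^n}\tilde a_{x\oplus y}^\dagger\tilde a_x,\qquad |\mathrm{init}_S\rangle=\frac1{\sqrt{\ell!}}(\tilde a_0^\dagger)^\ell|\mathrm{vac}\rangle .$$ The operators $\tilde G_y^2$ are positive semidefinite and commute pairwise. Let $\mathsf U=\bigotimes_{y\in\{0,1\}^n}\mathsf U_y$ consist of one qubit $\mathsf U_y$ with orthonormal basis $|\bot\rangle,|\top\rangle$ for each $y$, and let $K^0_{\mathsf U_y}$ and $K^1_{\mathsf U_y}$ be the Pauli operators $Z$ and $X$ on $\mathsf U_y$ in this basis. Put $|\mathrm{init}\rangle=|\bot\rangle^{\otimes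 2^n}\otimes|\mathrm{init}_S\rangle$. Let $\mathsf A$ be the algorithm's register, with basis $|b,y,z\rangle$, where $b\in\{0,1\}$, $y\in\{0,1\}^n$ and $z\in\{0,1\}^w$ (workspace of arbitrary finite size $w\ge 0$), and let $A$ be a unitary on $\mathsf A$. For $\mathbf y\in(\{0,1\}^n)^T$ and $\mathbf b\in\{0,1\}^T$ put $$A_{\mathbf y,\mathbf b}=A|b_T,y_T\rangle\langle b_T,y_T|\cdots A|b_1,y_1\rangle\langle b_1,y_1| ,$$ let $\mathbf y^{\mathbf b}=(y_i: b_i=1)$ be the ordered tuple, of length $|\mathbf b|=\sum_i b_i$, of the active query points, and for $\mathbf x\in\{0,1\}^{|\mathbf b|}$ let $(K^{\mathbf x})_{\mathbf y,\mathbf b}=K^{x_{|\mathbf b|}}_{\mathsf U_{y^{\mathbf b}_{|\mathbf b|}}}\cdots K^{x_1}_{\mathsf U_{y^{\mathbf b}_1}}$ (the first query acts first). For a family of functions $f_{\mathbf x}(\gamma_1,\dots,\gamma_k)$, $\mathbf x\in\{0,1\}^k$, $0\le k\le T$, define $$|\psi_f\rangle=\sum_{\mathbf y,\mathbf b}\Bigl[A_{\mathbf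 y,\mathbf b}\otimes\sum_{\mathbf x\in\{0,1\}^{|\mathbf b|}}(K^{\mathbf x})_{\mathbf y,\mathbf b}\otimes f_{\mathbf x}\bigl(\tilde G^2_{y^{\mathbf b}_1},\dots,\tilde G^2_{y^{\mathbf b}_{|\mathbf b|}}\bigr)\Bigr]A|0\rangle\otimes|\mathrm{init}\rangle .$$ The post-query state $|\psi_{\mathrm{PQ}}\rangle$ is $|\psi_e\rangle$ for $e_{\mathbf x}(\gamma_1,\dots,\gamma_k)=\prod_i e_{x_i}(\gamma_i)$, where $e_0(\gamma)=1-\mathrm e^{-\kappa\gamma}$ and $e_1(\gamma)=\sqrt{\mathrm e^{-\kappa\gamma}(2-\mathrm e^{-\kappa\gamma})}$. The algorithm given by $A$ *does not query at $0^n$* if $A_{\mathbf y,\mathbf b}A|0\rangle=0$ whenever $b_i=1$ and $y_i=0^n$ for some $i$. **Theorem.** There is an absolute constant $C>0$ such that for all integers $n,T\ge 0$ and every $\iota>0$ there are real polynomials $\mathrm{AKraus}_{\mathbf x}$ in $k$ variables ($\mathbf x\in\{0,1\}^k$, $0\le k\le T$) with $$\deg(\mathrm{AKraus}_{\mathbf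 x})\le C\,n^2T^5\,\max(1,\ln T)\,\max(1,\ln(1/\iota))^2$$ (where $T^5\max(1,\ln T)$ is read as $0$ for $T=0$) such that for every $\ell\ge1$, every workspace size $w$ and every unitary $A$ whose $T$-query algorithm does not query at $0^n$, $$\bigl\|\,|\psi_{\mathrm{PQ}}\rangle-|\psi_{\mathrm{AKraus}}\rangle\bigr\|\le\iota .$$ In particular, $\deg(\mathrm{AKraus}_{\mathbf x})=O(n^2T^5\ln(T)\ln^2(1/\iota))$. -/

import Mathlib

open scoped Kronecker

noncomputable section

namespace BosonOracle

/-! ### Bosonic Fock space on `2^n` modes -/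

/-- Mode labels: `n`-bit strings. Addition is bitwise XOR; `0` is the string `0^n`. -/
abbrev Mode (n : ℕ) : Type := Fin n → ZMod 2

/-- The sign `(-1)^{x·y}`. -/
def sgn {n : ℕ} (x y : Mode n) : ℂ := (-1) ^ (x ⬝ᵥ y).val

/-- Finite-particle Fock space: finite linear combinations of the position Fock basis vectors
`|m⟩`, where `m x` is the number of bosons in the position mode `x`. -/
abbrev Fock (n : ℕ) : Type := (Mode n → ℕ) →₀ ℂ

/-- The vacuum `|0, …, 0⟩`. -/
def vac (n : ℕ) : Fock n := Finsupp.single 0 1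

/-- Position annihilation operator: `â_x |m⟩ = √(m x) |m - 1_x⟩` (zero if `m x = 0`). -/
def ann {n : ℕ} (x : Mode n) : Fock n →ₗ[ℂ] Fock n :=
  Finsupp.linearCombination ℂ fun m : Mode n → ℕ =>
    Finsupp.single (m - Pi.single x 1) ((Real.sqrt (m x) : ℝ) : ℂ)

/-- Position creation operator: `â_x† |m⟩ = √(m x + 1) |m + 1_x⟩`. -/
def cre {n : ℕ} (x : Mode n) : Fock n →ₗ[ℂ] Fock n :=
  Finsupp.linearCombination ℂ fun m : Mode n → ℕ =>
    Finsupp.single (m + Pi.single x 1) ((Real.sqrt (m x + 1) : ℝ) : ℂ)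

/-- Momentum annihilation operator `ã_y = 2^{-n/2} ∑_x (-1)^{x·y} â_x`. -/
def annMom {n : ℕ} (y : Mode n) : Fock n →ₗ[ℂ] Fock n :=
  (1 / ((Real.sqrt (2 ^ n) : ℝ) : ℂ)) • ∑ x : Mode n, sgn x y • ann x

/-- Momentum creation operator `ã_y† = 2^{-n/2} ∑_x (-1)^{x·y} â_x†`. -/
def creMom {n : ℕ} (y : Mode n) : Fock n →ₗ[ℂ] Fock n :=
  (1 / ((Real.sqrt (2 ^ n) : ℝ) : ℂ)) • ∑ x : Mode n, sgn x y • cre x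

/-- Single `y`-momentum hopping operator `G̃_y = ℓ^{-1/2} ∑_x ã_{x⊕y}† ã_x`. -/
def hop {n : ℕ} (ℓ : ℕ) (y : Mode n) : Fock n →ₗ[ℂ] Fock n :=
  (1 / ((Real.sqrt ℓ : ℝ) : ℂ)) • ∑ x : Mode n, creMom (x + y) ∘ₗ annMom x

/-- Index set of the position Fock basis of the space of exactly `ℓ` bosons. -/
abbrev RegS (n ℓ : ℕ) : Type := {m : Mode n → ℕ // ∑ x, m x = ℓ}

instance (n ℓ : ℕ) : Fintype (RegS n ℓ) :=
  Fintype.subtype ((Finset.univ : Finset (Mode n)).piAntidiag ℓ) (by simp)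

/-- The single hopping operator on the space of exactly `ℓ` bosons (which it maps to itself),
as a matrix in the position Fock basis. -/
def hopMatrix (n ℓ : ℕ) (y : Mode n) : Matrix (RegS n ℓ) (RegS n ℓ) ℂ :=
  Matrix.of fun m m' => hop ℓ y (Finsupp.single m'.1 1) m.1

/-- The operator `G̃_y²` on the space of exactly `ℓ` bosons. -/
def hopSq (n ℓ : ℕ) (y : Mode n) : Matrix (RegS n ℓ) (RegS n ℓ) ℂ := hopMatrix n ℓ y ^ 2

/-- The initial state of `S`: `(ℓ!)^{-1/2} (ã_0†)^ℓ |vac⟩`, in the position Fock basis. -/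
def initS (n ℓ : ℕ) : RegS n ℓ → ℂ := fun m =>
  ((1 / ((Real.sqrt (Nat.factorial ℓ) : ℝ) : ℂ)) •
    ((creMom (0 : Mode n)) ^ ℓ) (vac n)) m.1

/-! ### The register `U` of the purified oracle -/

/-- Basis of `U`: one qubit `U_y` for each `y`, in the basis `0 ↦ |⊥⟩`, `1 ↦ |⊤⟩`. -/
abbrev RegU (n : ℕ) : Type := Mode n → Fin 2

/-- The initial state `|⊥⟩^{⊗ 2^n}` of `U`. -/
def initU (n : ℕ) : RegU n → ℂ := fun u => if u = 0 then 1 else 0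

/-- Pauli `Z` on the qubit `U_y`, in the `⊥`/`⊤` basis. -/
def pauliZ {n : ℕ} (y : Mode n) : Matrix (RegU n) (RegU n) ℂ :=
  Matrix.diagonal fun u => (-1) ^ (u y).val

/-- Pauli `X` on the qubit `U_y`, in the `⊥`/`⊤` basis. -/
def pauliX {n : ℕ} (y : Mode n) : Matrix (RegU n) (RegU n) ℂ :=
  Matrix.of fun u u' => if u = Function.update u' y (1 - u' y) then 1 else 0

/-- The operator `K^x` on `U_y`: `K^0 = Z`, `K^1 = X`. -/
def opK {n : ℕ} (x : Fin 2) (y : Mode n) : Matrix (RegU n) (RegU n) ℂ :=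
  if x = 0 then pauliZ y else pauliX y

/-- Ordered product `K^{x_k} ⋯ K^{x_1}` on `U_{y_k}, …, U_{y_1}`: the first query acts first. -/
def opKs {n k : ℕ} (x : Fin k → Fin 2) (y : Fin k → Mode n) : Matrix (RegU n) (RegU n) ℂ :=
  (List.ofFn fun i => opK (x i) (y i)).reverse.prod

/-! ### The register `A` of the algorithm -/

/-- Basis of `A`: control bit `b`, query point `y`, and `w` workspace qubits. -/
abbrev RegA (n w : ℕ) : Type := Fin 2 × Mode n × (Fin w → Fin 2)

/-- The all-zero state of `A`. -/
def ketZero (n w : ℕ) : RegA n w → ℂ := fun a => if a = 0 then 1 else 0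

/-- The projector `|b,y⟩⟨b,y|` on the query register. -/
def proj {n w : ℕ} (b : Fin 2) (y : Mode n) : Matrix (RegA n w) (RegA n w) ℂ :=
  Matrix.diagonal fun a => if a.1 = b ∧ a.2.1 = y then 1 else 0

/-- `A_{y,b} = A |b_T,y_T⟩⟨b_T,y_T| ⋯ A |b_1,y_1⟩⟨b_1,y_1|`. -/
def pathOp {n w T : ℕ} (A : Matrix (RegA n w) (RegA n w) ℂ)
    (y : Fin T → Mode n) (b : Fin T → Fin 2) : Matrix (RegA n w) (RegA n w) ℂ :=
  (List.ofFn fun i => A * proj (b i) (y i)).reverse.prod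

/-- The `T`-query algorithm given by `A` does not query the oracle at `0^n`: every sequence of
queries in which some active query (`b_i = 1`) is made at `y_i = 0^n` has amplitude zero. -/
def NeverQueriesZero {n w : ℕ} (T : ℕ) (A : Matrix (RegA n w) (RegA n w) ℂ) : Prop :=
  ∀ (y : Fin T → Mode n) (b : Fin T → Fin 2),
    (∃ i, b i = 1 ∧ y i = 0) → (pathOp A y b).mulVec (A.mulVec (ketZero n w)) = 0

/-! ### States of the algorithm and the oracle after `T` queries -/

/-- The set of active queries, `{i : b_i = 1}`. -/
def active {T : ℕ} (b : Fin T → Fin 2) : Finset (Fin T) := Finset.univ.filter fun i => b i = 1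

/-- The ordered tuple `y^b` of the query points `y_i` with `b_i = 1`. -/
def activeTuple {n T : ℕ} (y : Fin T → Mode n) (b : Fin T → Fin 2) :
    Fin (active b).card → Mode n :=
  fun i => y ((active b).orderEmbOfFin rfl i)

/-- `A|0⟩ ⊗ |init⟩`. -/
def startVec {n w : ℕ} (ℓ : ℕ) (A : Matrix (RegA n w) (RegA n w) ℂ) :
    RegA n w × RegU n × RegS n ℓ → ℂ :=
  fun a => A.mulVec (ketZero n w) a.1 * (initU n a.2.1 * initS n ℓ a.2.2)

/-- The (possibly unnormalised) state
`∑_{y,b} [A_{y,b} ⊗ ∑_x K^x_{y,b} ⊗ F_x(y^b)] A|0⟩ ⊗ |init⟩`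
for a family `F` of operators on `S`, indexed by `x ∈ {0,1}^k` and `k` query points. -/
def stateOf {n w : ℕ} (ℓ T : ℕ) (A : Matrix (RegA n w) (RegA n w) ℂ)
    (F : (k : ℕ) → (Fin k → Fin 2) → (Fin k → Mode n) → Matrix (RegS n ℓ) (RegS n ℓ) ℂ) :
    EuclideanSpace ℂ (RegA n w × RegU n × RegS n ℓ) :=
  WithLp.toLp 2 (∑ y : Fin T → Mode n, ∑ b : Fin T → Fin 2,
    (pathOp A y b ⊗ₖ
      ∑ x : Fin (active b).card → Fin 2,
        opKs x (activeTuple y b) ⊗ₖ F _ x (activeTuple y b)).mulVec (startVec ℓ A))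

/-! ### Kraus functions and polynomials in the operators `G̃_y²` -/

/-- The constant `κ = 1/10` of the oracle distribution. -/
def kappa : ℝ := 1 / 10

/-- `e_0(γ) = 1 - exp(-κγ)` and `e_1(γ) = √(exp(-κγ) (2 - exp(-κγ)))`. -/
def krausFun (x : Fin 2) (γ : ℝ) : ℝ :=
  if x = 0 then 1 - Real.exp (-kappa * γ)
  else Real.sqrt (Real.exp (-kappa * γ) * (2 - Real.exp (-kappa * γ)))

/-- `e_x(G̃_{y_1}², …, G̃_{y_k}²) = ∏_i e_{x_i}(G̃_{y_i}²)`, by the functional calculus of the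
commuting Hermitian matrices `G̃_{y_i}²`. -/
def krausOp (n ℓ : ℕ) (k : ℕ) (x : Fin k → Fin 2) (y : Fin k → Mode n) :
    Matrix (RegS n ℓ) (RegS n ℓ) ℂ :=
  (List.ofFn fun i => cfc (krausFun (x i)) (hopSq n ℓ (y i))).prod

/-- `p(G̃_{y_1}², …, G̃_{y_k}²)` for a real polynomial `p` in `k` variables. The operators commute,
so the order of the factors in a monomial is immaterial. -/
def polyOp (n ℓ : ℕ) {k : ℕ} (p : MvPolynomial (Fin k) ℝ) (y : Fin k → Mode n) :
    Matrix (RegS n ℓ) (RegS n ℓ) ℂ :=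
  ∑ d ∈ p.support, ((p.coeff d : ℝ) : ℂ) • (List.ofFn fun i => hopSq n ℓ (y i) ^ d i).prod

/-- The post-query state `|ψ_PQ⟩` of a `T`-query algorithm. -/
def psiPQ {n w : ℕ} (ℓ T : ℕ) (A : Matrix (RegA n w) (RegA n w) ℂ) :
    EuclideanSpace ℂ (RegA n w × RegU n × RegS n ℓ) :=
  stateOf ℓ T A (krausOp n ℓ)

/-- The state obtained from `|ψ_PQ⟩` by replacing the Kraus functions by polynomials `P`. -/
def psiPoly {n w : ℕ} (ℓ T : ℕ) (A : Matrix (RegA n w) (RegA n w) ℂ)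
    (P : (k : ℕ) → (Fin k → Fin 2) → MvPolynomial (Fin k) ℝ) :
    EuclideanSpace ℂ (RegA n w × RegU n × RegS n ℓ) :=
  stateOf ℓ T A fun k x y => polyOp n ℓ (P k x) y

end BosonOracle

end

/-!
Everything is diagonal in the position Fock basis `|m⟩`. The hopping operator is
`G̃_y = ℓ^{-1/2} ∑_x (-1)^{x·y} â_x† â_x`, so `G̃_y²` acts on `|m⟩` as the number
`γ_y(m) = (∑_x (-1)^{x·y} m_x)² / ℓ` (`hopSq_eq_diagonal`), and in the initial state the `ℓ` bosons
occupy independent uniformly random positions (`sum_norm_initS_sq_mul_prod_pow`). For `y ≠ 0` the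
quantity `γ_y` is therefore the square of a normalised sum of `ℓ` random signs, with
`E γ_y^a ≤ 2 (2 e a)^a` for every `ℓ` (`sum_norm_initS_sq_mul_hopEig_pow_le`).

For a fixed configuration `m` the state of algorithm and oracle is `(A V)^T` applied to the initial
vector, where `V` applies `f_0(γ_y) Z + f_1(γ_y) X` to `U_y`, controlled by the query register
(`stateOf_apply`). As `Z` and `X` anticommute and `e_0² + e_1² = 1`, the operator for the Kraus
functions is a contraction, so replacing `e` by functions that are `δ`-close at all `γ_y`, `y ≠ 0`,
costs at most `(1 + δ)^T - 1` (`norm_psiPQ_sub_psiPoly_sq_le`).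

It remains to choose one-variable polynomials `p_0`, `p_1` of degree `D` and to use the products
`∏_i p_{x_i}(γ_i)`. Both `e_0` and `e_1` are absolutely convergent superpositions of exponentials
`exp (-s γ)`; for `e_1 = √2 √q √(1 - q / 2)`, `q = exp (-κ γ)`, this is the binomial series. Their
truncated Chebyshev series on `[0, R]` have error `O(exp (-D / √R))` there and grow at most like
`(6 γ / R)^D` beyond `R` (`exists_krausFun_approx`). The tail `γ > R` contributes moments of order
`2 D T`, which the bound above controls when `R` is a large multiple of `D T`, and then `D / √R` is
of order `√(D / T)`. So the uniform error is small enough once `D` exceeds a multiple of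
`T (T + ln (1 / ι))²`; the union bound over the `2^n` points `y` requires in addition that `D T`
exceed a multiple of `n` (`exists_degree`). The bound of the theorem leaves room for both.
-/

noncomputable section

namespace BosonOracle

/-! ### Polynomial approximation by truncated Chebyshev series -/

open Polynomial in
lemma abs_eval_chebyshevT_le (n : ℕ) {x : ℝ} (hx : 1 ≤ |x|) :
    |(Chebyshev.T ℝ n).eval x| ≤ (3 * |x|) ^ n := by
  induction n using Nat.twoStepInduction with
  | zero => simp
  | one => simp; linarith
  | more n h0 h1 =>
    have e : (Chebyshev.T ℝ ((n + 2 : ℕ) : ℤ)).eval x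
        = 2 * x * (Chebyshev.T ℝ ((n + 1 : ℕ) : ℤ)).eval x - (Chebyshev.T ℝ (n : ℤ)).eval x := by
      push_cast
      rw [Chebyshev.T_add_two]; simp
    rw [e]
    have hp : 0 ≤ (3 * |x|) ^ n := by positivity
    calc |2 * x * (Chebyshev.T ℝ ((n + 1 : ℕ) : ℤ)).eval x - (Chebyshev.T ℝ (n : ℤ)).eval x|
        ≤ 2 * |x| * (3 * |x|) ^ (n + 1) + (3 * |x|) ^ n := by
          refine (abs_sub _ _).trans ?_
          rw [abs_mul, abs_mul, abs_two]
          gcongr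
      _ = (6 * |x| ^ 2 + 1) * (3 * |x|) ^ n := by ring
      _ ≤ (9 * |x| ^ 2) * (3 * |x|) ^ n := by gcongr; nlinarith
      _ = _ := by ring

open Polynomial in
/-- Truncation of a Chebyshev series with exponentially weighted summable coefficients. The terms
are indexed by an arbitrary type, so that several terms may carry the same Chebyshev polynomial. -/
theorem exists_polynomial_of_hasSum_chebyshev {α : Type*} (c : α → ℝ) (k : α → ℤ) {θ B : ℝ}
    (hθ : 0 ≤ θ) (hB : 0 < B) (hs : Summable fun a => |c a| * Real.exp (θ * |(k a : ℝ)|))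
    (hsB : ∑' a, |c a| * Real.exp (θ * |(k a : ℝ)|) ≤ B) (f : ℝ → ℝ)
    (hf : ∀ x, |x| ≤ 1 → HasSum (fun a => c a * (Chebyshev.T ℝ (k a)).eval x) (f x)) (D : ℕ) :
    ∃ p : ℝ[X], p.natDegree ≤ D ∧
      (∀ x, |x| ≤ 1 → |f x - p.eval x| ≤ 2 * B * Real.exp (-(θ * D))) ∧
      ∀ x, 1 ≤ |x| → |p.eval x| ≤ B * (3 * |x|) ^ D := by
  classical
  set g : α → ℝ := fun a => |c a| * Real.exp (θ * |(k a : ℝ)|) with hg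
  have hcg : ∀ a, |c a| ≤ g a := fun a =>
    le_mul_of_one_le_right (abs_nonneg _) (Real.one_le_exp (by positivity))
  have hc : Summable fun a => |c a| := Summable.of_nonneg_of_le (fun _ => abs_nonneg _) hcg hs
  have hε : 0 < B * Real.exp (-(θ * D)) := by positivity
  obtain ⟨s, hsε⟩ : ∃ s : Finset α, ∑' a, |c a| - ∑ a ∈ s, |c a| ≤ B * Real.exp (-(θ * D)) := by
    have := (hc.hasSum.eventually (lt_mem_nhds (sub_lt_self (∑' a, |c a|) hε))).exists
    obtain ⟨s, h⟩ := this
    exact ⟨s, by linarith⟩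
  -- Keep finitely many terms of degree at most `D`: the terms outside `s` are negligible and those
  -- of larger degree are small by the exponential weight.
  set s' := s.filter fun a => (k a).natAbs ≤ D with hs'
  refine ⟨∑ a ∈ s', C (c a) * Chebyshev.T ℝ (k a), ?_, ?_, ?_⟩
  · refine natDegree_sum_le_of_forall_le _ _ fun a ha => ?_
    refine (natDegree_C_mul_le _ _).trans ?_
    rw [Chebyshev.natDegree_T]
    exact (Finset.mem_filter.1 ha).2
  · intro x hx
    set t : α → ℝ := fun a => c a * (Chebyshev.T ℝ (k a)).eval x with ht
    have htc : ∀ a, |t a| ≤ |c a| := fun a => by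
      rw [ht, abs_mul]
      exact mul_le_of_le_one_right (abs_nonneg _)
        (Chebyshev.abs_eval_T_real_le_one (k a) hx)
    have h1 : HasSum (fun a => t a - if a ∈ s' then t a else 0)
        (f x - ∑ a ∈ s', t a) := by
      refine (hf x hx).sub ?_
      have : HasSum (fun a => if a ∈ s' then t a else 0) _ :=
        hasSum_sum_of_ne_finset_zero (s := s') (fun b hb => by simp [hb])
      rwa [Finset.sum_congr rfl fun a ha => if_pos ha] at this
    have h2 : HasSum (fun a => (|c a| - if a ∈ s then |c a| else 0) + g a * Real.exp (-(θ * D)))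
        ((∑' a, |c a| - ∑ a ∈ s, |c a|) + (∑' a, g a) * Real.exp (-(θ * D))) := by
      refine (hc.hasSum.sub ?_).add (hs.hasSum.mul_right _)
      have : HasSum (fun a => if a ∈ s then |c a| else 0) _ :=
        hasSum_sum_of_ne_finset_zero (s := s) (fun b hb => by simp [hb])
      rwa [Finset.sum_congr rfl fun a ha => if_pos ha] at this
    have h3 := h1.norm_le_of_bounded h2 (fun a => by
      have hga : 0 ≤ g a * Real.exp (-(θ * D)) := by positivity
      rw [Real.norm_eq_abs]
      by_cases ha : a ∈ s
      · by_cases hk : (k a).natAbs ≤ D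
        · simp [hs', ha, hk, hga]
        · have : |c a| ≤ g a * Real.exp (-(θ * D)) := by
            rw [hg]; dsimp only
            rw [mul_assoc, ← Real.exp_add]
            refine le_mul_of_one_le_right (abs_nonneg _) (Real.one_le_exp ?_)
            have : (D : ℝ) ≤ |(k a : ℝ)| := by
              have : (D : ℤ) ≤ |k a| := by rw [Int.abs_eq_natAbs]; omega
              exact_mod_cast this
            nlinarith
          simpa [hs', ha, hk] using (htc a).trans this
      · simpa [hs', ha] using (htc a).trans (le_add_of_nonneg_right hga))
    rw [Real.norm_eq_abs] at h3
    have h4 : (∑' a, g a) * Real.exp (-(θ * D)) ≤ B * Real.exp (-(θ * D)) := by gcongr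
    simp only [eval_finsetSum, eval_mul, eval_C]
    linarith
  · intro x hx
    simp only [eval_finsetSum, eval_mul, eval_C]
    calc |∑ a ∈ s', c a * (Chebyshev.T ℝ (k a)).eval x|
        ≤ ∑ a ∈ s', |c a| * (3 * |x|) ^ D := by
          refine (Finset.abs_sum_le_sum_abs _ _).trans (Finset.sum_le_sum fun a ha => ?_)
          rw [abs_mul]
          gcongr
          have hk := (Finset.mem_filter.1 ha).2
          rw [← Chebyshev.T_natAbs]
          exact (abs_eval_chebyshevT_le _ hx).trans
            (pow_le_pow_right₀ (by linarith) hk)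
      _ = (∑ a ∈ s', |c a|) * (3 * |x|) ^ D := by rw [Finset.sum_mul]
      _ ≤ B * (3 * |x|) ^ D := by
          gcongr
          exact ((Finset.sum_le_sum fun a _ => hcg a).trans
            (hs.sum_le_tsum _ fun a _ => (abs_nonneg _).trans (hcg a))).trans hsB

open Polynomial in
/-- The Chebyshev expansion of the exponential, with the modified Bessel coefficients written
out as double series: it is the product of `exp (lam / 2 * exp (± I w))` at `x = cos w`. -/
lemma hasSum_chebyshev_exp (lam x : ℝ) :
    HasSum (fun ij : ℕ × ℕ => (lam / 2) ^ ij.1 / ij.1.factorial * ((lam / 2) ^ ij.2 / ij.2.factorial)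
      * (Chebyshev.T ℝ ((ij.1 : ℤ) - ij.2)).eval x) (Real.exp (lam * x)) := by
  obtain ⟨w, hw⟩ := Complex.cos_surjective (x : ℂ)
  have key : ∀ u : ℂ, HasSum (fun ij : ℕ × ℕ =>
      ((lam / 2 * Complex.exp u) ^ ij.1 / ij.1.factorial)
        * ((lam / 2 * Complex.exp (-u)) ^ ij.2 / ij.2.factorial))
      (Complex.exp (lam / 2 * Complex.exp u) * Complex.exp (lam / 2 * Complex.exp (-u))) := by
    intro u
    have e : ∀ z : ℂ, HasSum (fun i : ℕ => z ^ i / i.factorial) (Complex.exp z) := fun z => by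
      rw [Complex.exp_eq_exp_ℂ]; exact NormedSpace.expSeries_div_hasSum_exp z
    have e' : ∀ z : ℂ, Summable (fun i : ℕ => ‖z ^ i / i.factorial‖) := fun z =>
      NormedSpace.norm_expSeries_div_summable z
    generalize (lam / 2 * Complex.exp u : ℂ) = z₁
    generalize (lam / 2 * Complex.exp (-u) : ℂ) = z₂
    have hs := summable_mul_of_summable_norm (e' z₁) (e' z₂)
    have h := HasSum.mul (e z₁) (e z₂) hs
    exact h
  have h := ((key (w * Complex.I)).add (key (-(w * Complex.I)))).mul_left (1 / 2)
  rw [← Complex.hasSum_ofReal]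
  convert h using 1
  · rfl
  · funext ij
    have hT : (((Chebyshev.T ℝ ((ij.1 : ℤ) - ij.2)).eval x : ℝ) : ℂ)
        = Complex.cos (((ij.1 : ℤ) - ij.2 : ℤ) * w) := by
      rw [← Chebyshev.T_complex_cos, hw]
      exact Chebyshev.complex_ofReal_eval_T x _
    push_cast
    push_cast at hT
    rw [hT, Complex.cos, mul_pow, mul_pow, mul_pow, mul_pow, ← Complex.exp_nat_mul,
      ← Complex.exp_nat_mul, ← Complex.exp_nat_mul, ← Complex.exp_nat_mul, neg_neg,
      show ((ij.1 : ℂ) - ij.2) * w * Complex.I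
        = ij.1 * (w * Complex.I) + ij.2 * (-(w * Complex.I)) by ring,
      show -(((ij.1 : ℂ) - ij.2) * w) * Complex.I
        = ij.1 * (-(w * Complex.I)) + ij.2 * (w * Complex.I) by ring,
      Complex.exp_add, Complex.exp_add]
    ring
  · push_cast
    rw [neg_neg, ← Complex.exp_add, ← Complex.exp_add, ← hw, Complex.cos]
    rw [show -w * Complex.I = -(w * Complex.I) by ring]
    ring_nf

open Polynomial in
/-- The weighted sum of the Chebyshev coefficients of `exp (lam * x)` is controlled by the value
of the exponential at the end `cosh θ` of the Bernstein ellipse. -/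
lemma sum_chebyshev_exp_weight {lam θ : ℝ} (hlam : 0 ≤ lam) (hθ : 0 ≤ θ) :
    Summable (fun ij : ℕ × ℕ => (lam / 2) ^ ij.1 / ij.1.factorial
        * ((lam / 2) ^ ij.2 / ij.2.factorial) * Real.exp (θ * |(((ij.1 : ℤ) - ij.2 : ℤ) : ℝ)|)) ∧
      ∑' ij : ℕ × ℕ, (lam / 2) ^ ij.1 / ij.1.factorial
        * ((lam / 2) ^ ij.2 / ij.2.factorial) * Real.exp (θ * |(((ij.1 : ℤ) - ij.2 : ℤ) : ℝ)|)
        ≤ 2 * Real.exp (lam * Real.cosh θ) := by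
  have h := (hasSum_chebyshev_exp lam (Real.cosh θ)).mul_left 2
  have hle : ∀ ij : ℕ × ℕ, (lam / 2) ^ ij.1 / ij.1.factorial
      * ((lam / 2) ^ ij.2 / ij.2.factorial) * Real.exp (θ * |(((ij.1 : ℤ) - ij.2 : ℤ) : ℝ)|)
      ≤ 2 * ((lam / 2) ^ ij.1 / ij.1.factorial * ((lam / 2) ^ ij.2 / ij.2.factorial)
      * (Chebyshev.T ℝ ((ij.1 : ℤ) - ij.2)).eval (Real.cosh θ)) := by
    intro ij
    rw [Chebyshev.T_real_cosh, mul_left_comm 2]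
    gcongr
    rw [← Real.cosh_abs, abs_mul, abs_of_nonneg hθ, mul_comm θ, Real.cosh_eq]
    have := Real.exp_pos (-(|(((ij.1 : ℤ) - ij.2 : ℤ) : ℝ)| * θ))
    push_cast at this ⊢
    linarith
  have hsum := Summable.of_nonneg_of_le (fun ij => by positivity) hle h.summable
  exact ⟨hsum, (hsum.tsum_le_tsum hle h.summable).trans h.tsum_eq.le⟩

open Polynomial in
/-- A superposition of decaying exponentials is approximated on `[0, R]` by polynomials of degree
`D` with error `exp (-D / √R)`. The parameter of the Bernstein ellipse is `1 / √R`, so that in the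
original variable the ellipse extends a bounded distance to the left of `0` and the weights stay
independent of `R`. -/
theorem exists_polynomial_of_hasSum_exp (b s : ℕ → ℝ) (hs : ∀ j, 0 ≤ s j) {B : ℝ} (hB : 0 < B)
    (hb : Summable fun j => |b j| * Real.exp (s j / 2))
    (hbB : 2 * ∑' j, |b j| * Real.exp (s j / 2) ≤ B) (f : ℝ → ℝ)
    (hf : ∀ t, 0 ≤ t → HasSum (fun j => b j * Real.exp (-(s j * t))) (f t))
    {R : ℝ} (hR : 1 ≤ R) (D : ℕ) :
    ∃ p : ℝ[X], p.natDegree ≤ D ∧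
      (∀ t, 0 ≤ t → t ≤ R → |f t - p.eval t| ≤ 2 * B * Real.exp (-(D / √R))) ∧
      ∀ t, R ≤ t → |p.eval t| ≤ B * (6 * t / R) ^ D := by
  have hR0 : 0 < R := by linarith
  set θ : ℝ := 1 / √R with hθ
  have hθ0 : 0 ≤ θ := by positivity
  have hθ2 : θ ^ 2 = 1 / R := by rw [hθ, div_pow, Real.sq_sqrt hR0.le, one_pow]
  have hcosh : Real.cosh θ - 1 ≤ θ ^ 2 := by
    have h1 : Real.cosh θ ≤ Real.exp (θ ^ 2 / 2) := Real.cosh_le_exp_half_sq θ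
    have h2 : θ ^ 2 ≤ 1 := by rw [hθ2, div_le_one hR0]; exact hR
    have h3 := Real.abs_exp_sub_one_le (x := θ ^ 2 / 2)
      (by rw [abs_of_nonneg] <;> nlinarith [sq_nonneg θ])
    rw [abs_of_nonneg (by positivity : 0 ≤ θ ^ 2 / 2)] at h3
    linarith [le_abs_self (Real.exp (θ ^ 2 / 2) - 1)]
  set lam : ℕ → ℝ := fun j => s j * R / 2 with hlam
  have hlam0 : ∀ j, 0 ≤ lam j := fun j => by have := hs j; positivity
  set w : ℕ → ℕ × ℕ → ℝ := fun j ij => (lam j / 2) ^ ij.1 / ij.1.factorial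
        * ((lam j / 2) ^ ij.2 / ij.2.factorial) with hw
  have hw0 : ∀ j ij, 0 ≤ w j ij := fun j ij => by have := hlam0 j; positivity
  set c : ℕ × ℕ × ℕ → ℝ := fun a => b a.1 * Real.exp (-lam a.1) * w a.1 a.2 with hc
  set k : ℕ × ℕ × ℕ → ℤ := fun a => (a.2.1 : ℤ) - a.2.2 with hk
  have habs : ∀ a : ℕ × ℕ × ℕ, |c a| * Real.exp (θ * |(k a : ℝ)|)
      = |b a.1| * Real.exp (-lam a.1) * (w a.1 a.2 * Real.exp (θ * |(k a : ℝ)|)) := fun a => by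
    rw [hc]; dsimp only
    rw [abs_mul, abs_mul, abs_of_pos (Real.exp_pos _), abs_of_nonneg (hw0 _ _)]; ring
  have hfib : ∀ j, Summable (fun ij : ℕ × ℕ => |c (j, ij)| * Real.exp (θ * |(k (j, ij) : ℝ)|)) := by
    intro j
    simp only [habs]
    exact (sum_chebyshev_exp_weight (hlam0 j) hθ0).1.mul_left _
  have hfibsum : ∀ j, ∑' ij : ℕ × ℕ, |c (j, ij)| * Real.exp (θ * |(k (j, ij) : ℝ)|)
      ≤ 2 * (|b j| * Real.exp (s j / 2)) := by
    intro j
    simp only [habs]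
    rw [tsum_mul_left]
    calc _ ≤ |b j| * Real.exp (-lam j) * (2 * Real.exp (lam j * Real.cosh θ)) := by
          gcongr
          exact (sum_chebyshev_exp_weight (hlam0 j) hθ0).2
      _ = 2 * (|b j| * Real.exp (lam j * (Real.cosh θ - 1))) := by
          rw [show lam j * (Real.cosh θ - 1) = -lam j + lam j * Real.cosh θ by ring, Real.exp_add]
          ring
      _ ≤ 2 * (|b j| * Real.exp (s j / 2)) := by
          gcongr
          calc lam j * (Real.cosh θ - 1) ≤ lam j * θ ^ 2 := by gcongr; exact hlam0 j
            _ = s j / 2 := by rw [hθ2, hlam]; field_simp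
  have hnn : ∀ a, 0 ≤ |c a| * Real.exp (θ * |(k a : ℝ)|) := fun a => by positivity
  have hsum2 : Summable (fun j => ∑' ij : ℕ × ℕ, |c (j, ij)| * Real.exp (θ * |(k (j, ij) : ℝ)|)) :=
    Summable.of_nonneg_of_le (fun j => tsum_nonneg fun ij => hnn _) hfibsum (hb.mul_left 2)
  have hsummable : Summable fun a => |c a| * Real.exp (θ * |(k a : ℝ)|) :=
    (summable_prod_of_nonneg hnn).2 ⟨hfib, hsum2⟩
  have hle : ∑' a, |c a| * Real.exp (θ * |(k a : ℝ)|) ≤ B := by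
    rw [hsummable.tsum_prod' hfib]
    refine (hsum2.tsum_le_tsum hfibsum (hb.mul_left 2)).trans ?_
    rwa [tsum_mul_left]
  have hcs : Summable c := by
    refine Summable.of_norm_bounded hsummable fun a => ?_
    rw [Real.norm_eq_abs]
    exact le_mul_of_one_le_right (abs_nonneg _) (Real.one_le_exp (by positivity))
  obtain ⟨p, hpD, hp1, hp2⟩ := exists_polynomial_of_hasSum_chebyshev c k hθ0 hB hsummable hle
    (fun x => f (R * (1 - x) / 2)) (fun x hx => by
      have hx' := abs_le.1 hx
      have h1 : Summable fun a => c a * (Chebyshev.T ℝ (k a)).eval x := by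
        refine Summable.of_norm_bounded hcs.abs fun a => ?_
        rw [norm_mul, Real.norm_eq_abs, Real.norm_eq_abs]
        exact mul_le_of_le_one_right (abs_nonneg _)
          (Chebyshev.abs_eval_T_real_le_one (k a) hx)
      have h2 : HasSum (fun j => b j * Real.exp (-lam j) * Real.exp (lam j * x))
          (∑' a, c a * (Chebyshev.T ℝ (k a)).eval x) := h1.hasSum.prod_fiberwise fun j => by
        refine ((hasSum_chebyshev_exp (lam j) x).mul_left (b j * Real.exp (-lam j))).congr_fun
          fun ij => ?_
        simp only [hc, hk, hw]; ring
      have h3 : HasSum (fun j => b j * Real.exp (-lam j) * Real.exp (lam j * x))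
          (f (R * (1 - x) / 2)) := by
        refine (hf (R * (1 - x) / 2) (by nlinarith)).congr_fun fun j => ?_
        rw [mul_assoc, ← Real.exp_add]
        congr 2
        simp only [hlam]; ring
      rw [← h2.unique h3]
      exact h1.hasSum) D
  refine ⟨p.comp (C 1 - C (2 / R) * X), ?_, fun t ht0 htR => ?_, fun t ht => ?_⟩
  · refine natDegree_comp_le.trans ?_
    have : (C 1 - C (2 / R) * X : ℝ[X]).natDegree ≤ 1 := by compute_degree
    calc p.natDegree * _ ≤ D * 1 := Nat.mul_le_mul hpD this
      _ = D := mul_one D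
  · have h : |1 - 2 / R * t| ≤ 1 := by
      have : 2 / R * t ≤ 2 := by rw [div_mul_eq_mul_div, div_le_iff₀ hR0]; linarith
      have : 0 ≤ 2 / R * t := by positivity
      rw [abs_le]; constructor <;> linarith
    have := hp1 _ h
    have e : R * (1 - (1 - 2 / R * t)) / 2 = t := by field_simp; ring
    rw [e] at this
    simpa [hθ, div_eq_inv_mul] using this
  · have h1 : 2 / R * t = 2 * (t / R) := by ring
    have h2 : 1 ≤ t / R := by rwa [one_le_div hR0]
    have h : |1 - 2 / R * t| = 2 * (t / R) - 1 := by
      rw [h1, abs_of_nonpos (by linarith)]; ring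
    have := hp2 (1 - 2 / R * t) (by rw [h]; linarith)
    rw [h] at this
    simp only [eval_comp, eval_sub, eval_mul, eval_C, eval_X]
    refine this.trans ?_
    gcongr
    · linarith
    · rw [mul_div_assoc]; linarith

/-- The coefficients of the expansion of `krausFun 1` in powers of `q = exp (-κ γ)`: the binomial
series of `√(1 - q / 2)`, times `√2 √q`. -/
def krausCoeff (j : ℕ) : ℝ := √2 * (Ring.choose (1 / 2 : ℝ) j * (-1 / 2) ^ j)

/-- The coefficients of `√(1 + z)` are summable against `(3 / 4) ^ j`, which leaves room for the
factor `exp (κ / 2)` per step because `exp (1 / 20) / 2 < 3 / 4`. -/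
lemma summable_krausCoeff :
    Summable fun j : ℕ => |krausCoeff j| * Real.exp (kappa * (j + 1 / 2) / 2) := by
  have hlt : Real.exp (1 / 20) < 3 / 2 := by
    have h := Real.abs_exp_sub_one_le (x := 1 / 20) (by rw [abs_of_pos] <;> norm_num)
    rw [abs_of_pos (by norm_num : (0 : ℝ) < 1 / 20)] at h
    linarith [le_abs_self (Real.exp (1 / 20) - 1)]
  have h := (Real.one_add_rpow_hasFPowerSeriesOnBall_zero (a := 1 / 2)).r_le
  have h2 := (binomialSeries ℝ (1 / 2 : ℝ)).summable_norm_mul_pow (r := 3 / 4)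
    (lt_of_lt_of_le (by
      rw [← ENNReal.coe_one, ENNReal.coe_lt_coe]
      rw [div_lt_one] <;> norm_num) h)
  refine Summable.of_nonneg_of_le (fun j => by positivity) (fun j => ?_)
    (h2.mul_left (√2 * Real.exp (1 / 40)))
  have hn : ‖binomialSeries ℝ (1 / 2 : ℝ) j‖ = |Ring.choose (1 / 2 : ℝ) j| := by
    rw [binomialSeries, FormalMultilinearSeries.ofScalars_norm, Real.norm_eq_abs]
  rw [hn, krausCoeff, abs_mul, abs_mul, abs_pow, abs_of_nonneg (Real.sqrt_nonneg 2),
    show kappa * (j + 1 / 2) / 2 = 1 / 40 + j * (1 / 20) by rw [kappa]; ring, Real.exp_add,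
    Real.exp_nat_mul]
  have e : |(-1 / 2 : ℝ)| ^ j * Real.exp (1 / 20) ^ j ≤ (3 / 4) ^ j := by
    rw [← mul_pow]
    gcongr
    rw [abs_of_neg (by norm_num)]
    linarith
  calc _ = √2 * Real.exp (1 / 40) * (|Ring.choose (1 / 2 : ℝ) j|
        * (|(-1 / 2 : ℝ)| ^ j * Real.exp (1 / 20) ^ j)) := by ring
    _ ≤ √2 * Real.exp (1 / 40) * (|Ring.choose (1 / 2 : ℝ) j| * (3 / 4) ^ j) := by gcongr
    _ = _ := by simp

/-- `krausFun 1 = √2 √q √(1 - q / 2)` with `q = exp (-κ γ)`, as a superposition of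
exponentials. -/
lemma hasSum_krausFun_one {t : ℝ} (ht : 0 ≤ t) :
    HasSum (fun j : ℕ => krausCoeff j * Real.exp (-(kappa * (j + 1 / 2) * t)))
      (krausFun 1 t) := by
  set q := Real.exp (-kappa * t) with hq
  have hq0 : 0 < q := Real.exp_pos _
  have hq1 : q ≤ 1 := Real.exp_le_one_iff.2 (by rw [kappa]; linarith)
  have h := (Real.one_add_rpow_hasFPowerSeriesOnBall_zero (a := 1 / 2)).hasSum (y := -(q / 2)) (by
    rw [Metric.mem_eball, edist_zero_right, ← ofReal_norm, Real.norm_eq_abs, abs_neg,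
      abs_of_pos (by positivity)]
    rw [← ENNReal.ofReal_one]
    exact ENNReal.ofReal_lt_ofReal_iff_of_nonneg (by positivity) |>.2 (by linarith))
  have e : krausFun 1 t = √2 * √q * (1 + (0 + -(q / 2))) ^ (1 / 2 : ℝ) := by
    rw [← Real.sqrt_eq_rpow, krausFun, if_neg one_ne_zero, ← hq, ← Real.sqrt_mul (by norm_num),
      ← Real.sqrt_mul (by positivity)]
    congr 1; ring
  rw [e]
  refine (h.mul_left (√2 * √q)).congr_fun fun j => ?_
  rw [binomialSeries_apply, List.ofFn_const, List.prod_replicate, krausCoeff, smul_eq_mul,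
    show -(kappa * (j + 1 / 2) * t) = j * (-kappa * t) + -kappa * t / 2 by ring, Real.exp_add,
    Real.exp_nat_mul, Real.exp_half, ← hq, show -(q / 2) = (-1 / 2) * q by ring, mul_pow]
  ring

lemma hasSum_krausFun_zero (t : ℝ) :
    HasSum (fun j : ℕ => (if j = 0 then 1 else if j = 1 then -1 else 0)
      * Real.exp (-((if j = 1 then kappa else 0) * t))) (krausFun 0 t) := by
  have : HasSum _ _ := hasSum_sum_of_ne_finset_zero (s := Finset.range 2)
    (f := fun j : ℕ => (if j = 0 then (1 : ℝ) else if j = 1 then -1 else 0)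
      * Real.exp (-((if j = 1 then kappa else 0) * t))) (fun b hb => by
        rw [Finset.mem_range] at hb
        simp [show b ≠ 0 by omega, show b ≠ 1 by omega])
  convert this using 1
  simp [Finset.sum_range_succ, krausFun, sub_eq_add_neg]

lemma krausFun_sq_add_sq {t : ℝ} (ht : 0 ≤ t) : krausFun 0 t ^ 2 + krausFun 1 t ^ 2 = 1 := by
  have hq1 : Real.exp (-kappa * t) ≤ 1 := Real.exp_le_one_iff.2 (by rw [kappa]; linarith)
  have hq0 := Real.exp_pos (-kappa * t)
  rw [krausFun, krausFun, if_pos rfl, if_neg one_ne_zero,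
    Real.sq_sqrt (mul_nonneg hq0.le (by linarith))]
  ring

open Polynomial in
/-- Polynomial approximation of the Kraus functions on `[0, R]`, with controlled growth outside. -/
theorem exists_krausFun_approx : ∃ B : ℝ, 0 < B ∧ ∀ (x : Fin 2) (R : ℝ), 1 ≤ R → ∀ D : ℕ,
    ∃ p : ℝ[X], p.natDegree ≤ D ∧
      (∀ t, 0 ≤ t → t ≤ R → |krausFun x t - p.eval t| ≤ 2 * B * Real.exp (-(D / √R))) ∧
      ∀ t, R ≤ t → |p.eval t| ≤ B * (6 * t / R) ^ D := by
  set b0 : ℕ → ℝ := fun j => if j = 0 then 1 else if j = 1 then -1 else 0 with hb0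
  set s0 : ℕ → ℝ := fun j => if j = 1 then kappa else 0 with hs0
  have hk : 0 ≤ kappa := by rw [kappa]; norm_num
  have h0 : Summable fun j => |b0 j| * Real.exp (s0 j / 2) :=
    summable_of_ne_finset_zero (s := Finset.range 2) fun b hb => by
      rw [Finset.mem_range] at hb
      simp [hb0, show b ≠ 0 by omega, show b ≠ 1 by omega]
  have n0 : 0 ≤ ∑' j, |b0 j| * Real.exp (s0 j / 2) := tsum_nonneg fun _ => by positivity
  have n1 : 0 ≤ ∑' j : ℕ, |krausCoeff j| * Real.exp (kappa * (j + 1 / 2) / 2) :=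
    tsum_nonneg fun _ => by positivity
  refine ⟨1 + 2 * (∑' j, |b0 j| * Real.exp (s0 j / 2))
    + 2 * ∑' j : ℕ, |krausCoeff j| * Real.exp (kappa * (j + 1 / 2) / 2), by positivity,
    fun x R hR D => ?_⟩
  fin_cases x
  · exact exists_polynomial_of_hasSum_exp b0 s0
      (fun j => by rw [hs0]; dsimp only; split_ifs <;> simp [hk]) (by positivity)
      h0 (by linarith) (krausFun 0) (fun t _ => hasSum_krausFun_zero t) hR D
  · exact exists_polynomial_of_hasSum_exp krausCoeff (fun j => kappa * (j + 1 / 2))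
      (fun j => by positivity) (by positivity) summable_krausCoeff (by linarith)
      (krausFun 1) (fun t ht => hasSum_krausFun_one ht) hR D

/-! ### The hopping operators are diagonal in the position basis -/

/-- The sign `(-1)^{x·y}` as a real number. -/
def sgnR {n : ℕ} (x y : Mode n) : ℝ := (-1) ^ (x ⬝ᵥ y).val

lemma sgn_eq_ofReal {n : ℕ} (x y : Mode n) : sgn x y = (sgnR x y : ℂ) := by
  simp [sgn, sgnR]

lemma neg_one_pow_val_add (a b : ZMod 2) :
    (-1 : ℝ) ^ (a + b).val = (-1) ^ a.val * (-1) ^ b.val := by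
  rw [ZMod.val_add, ← pow_add, neg_one_pow_eq_pow_mod_two, Nat.mod_mod,
    ← neg_one_pow_eq_pow_mod_two]

lemma sgnR_add_left {n : ℕ} (x x' y : Mode n) : sgnR (x + x') y = sgnR x y * sgnR x' y := by
  rw [sgnR, add_dotProduct, neg_one_pow_val_add]; rfl

lemma sgnR_comm {n : ℕ} (x y : Mode n) : sgnR x y = sgnR y x := by
  rw [sgnR, sgnR, dotProduct_comm]

lemma sgnR_add_right {n : ℕ} (x y y' : Mode n) : sgnR x (y + y') = sgnR x y * sgnR x y' := by
  rw [sgnR_comm, sgnR_add_left, sgnR_comm y, sgnR_comm y']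

lemma sgnR_eq_one_or {n : ℕ} (x y : Mode n) : sgnR x y = 1 ∨ sgnR x y = -1 :=
  neg_one_pow_eq_or ℝ _

lemma sum_sgnR {n : ℕ} (y : Mode n) : ∑ x, sgnR x y = if y = 0 then (2 : ℝ) ^ n else 0 := by
  split_ifs with h
  · subst h
    simp [sgnR, ZMod.card]
  · obtain ⟨i, hi⟩ := Function.ne_iff.1 h
    have hy : y i = 1 := by
      have : ∀ a : ZMod 2, a ≠ 0 → a = 1 := by decide
      exact this _ hi
    have e : sgnR (Pi.single i 1 : Mode n) y = -1 := by
      simp [sgnR, hy, ZMod.val_one]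
    have h1 : ∑ x, sgnR x y = ∑ x, sgnR (x + (Pi.single i 1 : Mode n)) y :=
      (Equiv.sum_comp (Equiv.addRight (Pi.single i 1 : Mode n)) fun x => sgnR x y).symm
    simp only [sgnR_add_left, e] at h1
    rw [← Finset.sum_mul] at h1
    linarith

lemma Mode.add_eq_zero_iff {n : ℕ} {u v : Mode n} : u + v = 0 ↔ u = v := by
  rw [add_eq_zero_iff_eq_neg, show -v = v from funext fun i => ZMod.neg_eq_self_mod_two (v i)]

lemma sum_smul_comp_sum_smul {ι R V : Type*} [CommRing R] [AddCommGroup V] [Module R V]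
    (s : Finset ι) (a b : ι → R) (C A : ι → V →ₗ[R] V) :
    (∑ u ∈ s, a u • C u) ∘ₗ (∑ v ∈ s, b v • A v)
      = ∑ u ∈ s, ∑ v ∈ s, (a u * b v) • (C u ∘ₗ A v) := by
  simp only [← Module.End.mul_eq_comp, Finset.sum_mul_sum, smul_mul_smul_comm]

/-- Momentum hopping in the position basis: the sum over `x` forces the two position modes to
coincide. -/
lemma sum_creMom_annMom {n : ℕ} (y : Mode n) :
    ∑ x : Mode n, creMom (x + y) ∘ₗ annMom x = ∑ u : Mode n, sgn u y • (cre u ∘ₗ ann u) := by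
  have hN : (1 / ((√(2 ^ n) : ℝ) : ℂ)) * (1 / ((√(2 ^ n) : ℝ) : ℂ)) = 1 / 2 ^ n := by
    rw [div_mul_div_comm, ← Complex.ofReal_mul, Real.mul_self_sqrt (by positivity)]
    norm_num
  have h : ∀ x : Mode n, creMom (x + y) ∘ₗ annMom x = (1 / 2 ^ n : ℂ) •
      ∑ u : Mode n, ∑ v : Mode n, (sgn u y * sgn (u + v) x) • (cre u ∘ₗ ann v) := by
    intro x
    rw [creMom, annMom, LinearMap.comp_smul, LinearMap.smul_comp, smul_smul, hN]
    congr 1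
    rw [sum_smul_comp_sum_smul]
    refine Finset.sum_congr rfl fun u _ => Finset.sum_congr rfl fun v _ => ?_
    congr 1
    simp only [sgn_eq_ofReal, sgnR_add_left, sgnR_add_right]
    push_cast; ring
  simp only [h]
  rw [← Finset.smul_sum, Finset.sum_comm, Finset.smul_sum]
  refine Finset.sum_congr rfl fun u _ => ?_
  rw [Finset.sum_comm]
  simp only [← Finset.sum_smul, ← Finset.mul_sum]
  have h2 : ∀ v : Mode n, ∑ x : Mode n, sgn (u + v) x = if u = v then (2 : ℂ) ^ n else 0 := by
    intro v
    simp only [sgn_eq_ofReal, sgnR_comm (u + v)]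
    rw [← Complex.ofReal_sum, sum_sgnR]
    simp only [Mode.add_eq_zero_iff]
    split_ifs <;> simp
  simp only [h2, mul_ite, mul_zero, ite_smul, zero_smul, Finset.sum_ite_eq, Finset.mem_univ,
    if_true, smul_smul]
  congr 1
  field_simp

lemma cre_ann_single {n : ℕ} (u : Mode n) (m : Mode n → ℕ) :
    cre u (ann u (Finsupp.single m 1)) = Finsupp.single m (m u : ℂ) := by
  rw [ann, Finsupp.linearCombination_single, one_smul, cre, Finsupp.linearCombination_single,
    Finsupp.smul_single, smul_eq_mul, ← Complex.ofReal_mul]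
  rcases Nat.eq_zero_or_pos (m u) with h | h
  · simp [h]
  · have e : m - Pi.single u 1 + Pi.single u 1 = m := by
      refine tsub_add_cancel_of_le fun x => ?_
      by_cases hx : x = u
      · subst hx; simpa using Nat.succ_le_of_lt h
      · simp [hx]
    rw [e]
    congr 1
    have : (((m - Pi.single u 1 : Mode n → ℕ) u : ℕ) : ℝ) + 1 = m u := by
      have : (m - Pi.single u 1 : Mode n → ℕ) u = m u - 1 := by simp
      rw [this, Nat.cast_sub h]; simp
    rw [this, Real.mul_self_sqrt (by positivity)]
    simp

/-- The eigenvalue `(∑_x (-1)^{x·y} m_x)² / ℓ` of `G̃_y²` on the position basis vector `|m⟩`. -/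
def hopEig {n : ℕ} (ℓ : ℕ) (y : Mode n) (m : Mode n → ℕ) : ℝ :=
  (∑ x, sgnR x y * m x) ^ 2 / ℓ

lemma hopEig_nonneg {n : ℕ} (ℓ : ℕ) (y : Mode n) (m : Mode n → ℕ) : 0 ≤ hopEig ℓ y m := by
  rw [hopEig]; positivity

theorem hopSq_eq_diagonal (n ℓ : ℕ) (y : Mode n) :
    hopSq n ℓ y = Matrix.diagonal fun m : RegS n ℓ => (hopEig ℓ y m.1 : ℂ) := by
  have h : hopMatrix n ℓ y = Matrix.diagonal fun m : RegS n ℓ =>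
      (((∑ x, sgnR x y * m.1 x) / √ℓ : ℝ) : ℂ) := by
    ext m m'
    rw [hopMatrix, Matrix.of_apply, hop, sum_creMom_annMom, LinearMap.smul_apply,
      LinearMap.sum_apply]
    simp only [LinearMap.smul_apply, LinearMap.comp_apply, cre_ann_single]
    rw [Finsupp.smul_apply, Finsupp.finsetSum_apply, Matrix.diagonal_apply]
    simp only [Finsupp.smul_apply, Finsupp.single_apply, sgn_eq_ofReal, smul_eq_mul]
    by_cases hm : m = m'
    · subst hm
      simp only [if_true]
      push_cast
      ring
    · have hm' : m'.1 ≠ m.1 := fun h => hm (Subtype.ext h.symm)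
      simp [hm, hm']
  rw [hopSq, h, pow_two, Matrix.diagonal_mul_diagonal]
  congr 1
  funext m
  rw [← Complex.ofReal_mul, hopEig, ← pow_two, div_pow, Real.sq_sqrt (by positivity)]

/-! ### Functional calculus of diagonal matrices -/

lemma prod_ofFn_diagonal {ι R : Type*} [Fintype ι] [DecidableEq ι] [CommRing R] {k : ℕ}
    (d : Fin k → ι → R) :
    (List.ofFn fun i => Matrix.diagonal (d i)).prod = Matrix.diagonal fun m => ∏ i, d i m := by
  have h := map_list_prod (Matrix.diagonalRingHom ι R) (List.ofFn d)
  rw [List.map_ofFn, List.prod_ofFn] at h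
  rw [show (fun i => Matrix.diagonal (d i)) = ⇑(Matrix.diagonalRingHom ι R) ∘ d from rfl, ← h]
  change Matrix.diagonal (∏ i, d i) = _
  congr 1
  funext m
  rw [Finset.prod_apply]

open Polynomial in
lemma cfc_diagonal_ofReal {ι : Type*} [Fintype ι] [DecidableEq ι] (f : ℝ → ℝ) (d : ι → ℝ) :
    cfc f (Matrix.diagonal fun i => (d i : ℂ)) = Matrix.diagonal fun i => (f (d i) : ℂ) := by
  classical
  have haev : ∀ p : ℝ[X], aeval (Matrix.diagonal fun i => (d i : ℂ)) p
      = Matrix.diagonal fun i => ((p.eval (d i) : ℝ) : ℂ) := by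
    intro p
    have h : aeval ((Matrix.diagonalAlgHom ℝ (n := ι) (α := ℂ)) fun i => (d i : ℂ)) p
      = Matrix.diagonalAlgHom ℝ (aeval (fun i => (d i : ℂ)) p) := aeval_algHom_apply _ _ p
    change _ = Matrix.diagonal _ at h
    refine h.trans ?_
    congr 1
    funext i
    have h2 := aeval_algHom_apply (Pi.evalAlgHom ℝ (fun _ : ι => ℂ) i) (fun i => (d i : ℂ)) p
    rw [Pi.evalAlgHom_apply, Pi.evalAlgHom_apply] at h2
    rw [← h2]
    exact aeval_ofReal p (d i)
  have hsa : IsSelfAdjoint (Matrix.diagonal fun i => (d i : ℂ)) := by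
    rw [IsSelfAdjoint, Matrix.star_eq_conjTranspose, Matrix.diagonal_conjTranspose]
    congr 1; funext i; simp
  -- On the finite spectrum `f` agrees with its interpolation polynomial, for which the functional
  -- calculus is polynomial evaluation.
  set S : Finset ℝ := Finset.univ.image d
  set p : ℝ[X] := Lagrange.interpolate S id f with hp
  have hpS : ∀ i, p.eval (d i) = f (d i) := fun i =>
    Lagrange.eval_interpolate_at_node f (fun _ _ _ _ h => h)
      (Finset.mem_image_of_mem d (Finset.mem_univ i))
  have hspec : spectrum ℝ (Matrix.diagonal fun i => (d i : ℂ)) ⊆ S := by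
    intro r hr
    by_contra hS
    apply hr
    change IsUnit _
    rw [Matrix.isUnit_iff_isUnit_det]
    have : algebraMap ℝ (Matrix ι ι ℂ) r - Matrix.diagonal (fun i => (d i : ℂ))
        = Matrix.diagonal fun i => ((r - d i : ℝ) : ℂ) := by
      rw [Matrix.algebraMap_eq_diagonal, Matrix.diagonal_sub]
      congr 1; funext i; simp
    rw [this, Matrix.det_diagonal, isUnit_iff_ne_zero, Finset.prod_ne_zero_iff]
    intro i _ h0
    apply hS
    have : r = d i := by
      have := Complex.ofReal_eq_zero.1 h0
      linarith
    rw [this]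
    exact Finset.mem_coe.2 (Finset.mem_image_of_mem d (Finset.mem_univ i))
  have hcongr : cfc f (Matrix.diagonal fun i => (d i : ℂ))
      = cfc p.eval (Matrix.diagonal fun i => (d i : ℂ)) := by
    refine cfc_congr fun r hr => ?_
    obtain ⟨i, -, rfl⟩ := Finset.mem_image.1 (Finset.mem_coe.1 (hspec hr))
    exact (hpS i).symm
  rw [hcongr, cfc_polynomial p _ hsa, haev]
  simp only [hpS]

lemma krausOp_eq_diagonal (n ℓ k : ℕ) (x : Fin k → Fin 2) (y : Fin k → Mode n) :
    krausOp n ℓ k x y = Matrix.diagonal fun m : RegS n ℓ =>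
      ∏ i, (krausFun (x i) (hopEig ℓ (y i) m.1) : ℂ) := by
  simp only [krausOp, hopSq_eq_diagonal, cfc_diagonal_ofReal]
  exact prod_ofFn_diagonal _

/-- The product `∏_i p_{x_i}(X_i)` of one-variable polynomials, as a polynomial in `k` variables. -/
def prodPoly (p : Fin 2 → Polynomial ℝ) {k : ℕ} (x : Fin k → Fin 2) : MvPolynomial (Fin k) ℝ :=
  ∏ i, Polynomial.aeval (MvPolynomial.X i) (p (x i))

lemma totalDegree_prodPoly_le (p : Fin 2 → Polynomial ℝ) {D : ℕ} (hp : ∀ b, (p b).natDegree ≤ D)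
    {k : ℕ} (x : Fin k → Fin 2) : (prodPoly p x).totalDegree ≤ k * D := by
  have h : ∀ i, (Polynomial.aeval (MvPolynomial.X i : MvPolynomial (Fin k) ℝ)
      (p (x i))).totalDegree ≤ D := by
    intro i
    rw [Polynomial.aeval_eq_sum_range]
    refine MvPolynomial.totalDegree_finsetSum_le fun j hj => ?_
    refine (MvPolynomial.totalDegree_smul_le _ _).trans ?_
    rw [MvPolynomial.totalDegree_X_pow]
    exact (Nat.lt_succ_iff.1 (Finset.mem_range.1 hj)).trans (hp _)
  refine (MvPolynomial.totalDegree_finsetProd _ _).trans ?_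
  refine (Finset.sum_le_sum fun i _ => h i).trans ?_
  simp

lemma polyOp_prodPoly_eq_diagonal (n ℓ : ℕ) {k : ℕ} (p : Fin 2 → Polynomial ℝ)
    (x : Fin k → Fin 2) (y : Fin k → Mode n) :
    polyOp n ℓ (prodPoly p x) y = Matrix.diagonal fun m : RegS n ℓ =>
      ∏ i, (((p (x i)).eval (hopEig ℓ (y i) m.1) : ℝ) : ℂ) := by
  have h : ∀ q : MvPolynomial (Fin k) ℝ, polyOp n ℓ q y = Matrix.diagonal fun m : RegS n ℓ =>
      ((MvPolynomial.eval (fun i => hopEig ℓ (y i) m.1) q : ℝ) : ℂ) := by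
    intro q
    simp only [polyOp, hopSq_eq_diagonal, Matrix.diagonal_pow, prod_ofFn_diagonal]
    ext m m'
    rw [Matrix.sum_apply, Matrix.diagonal_apply]
    simp only [Matrix.smul_apply, Matrix.diagonal_apply, Pi.pow_apply, MvPolynomial.eval_eq']
    split_ifs
    · simp
    · simp
  rw [h]
  congr 1
  funext m
  rw [prodPoly, map_prod, Complex.ofReal_prod]
  refine Finset.prod_congr rfl fun i _ => ?_
  congr 1
  have := Polynomial.aeval_algHom_apply
    (MvPolynomial.aeval (R := ℝ) (fun i => hopEig ℓ (y i) m.1)) (MvPolynomial.X i) (p (x i))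
  rw [MvPolynomial.aeval_X] at this
  exact this.symm

/-! ### The distribution of the initial state over position configurations -/

lemma cre_apply {n : ℕ} (x : Mode n) (v : Fock n) (m : Mode n → ℕ) :
    cre x v m = if m x = 0 then 0 else ((√(m x) : ℝ) : ℂ) * v (m - Pi.single x 1) := by
  induction v using Finsupp.induction_linear with
  | zero => simp
  | add f g hf hg =>
    rw [map_add, Finsupp.add_apply, hf, hg, Finsupp.add_apply]
    split_ifs <;> ring
  | single m' c =>
    rw [cre, Finsupp.linearCombination_single, Finsupp.smul_single, Finsupp.single_apply,
      Finsupp.single_apply, smul_eq_mul]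
    by_cases h : m' + Pi.single x 1 = m
    · have hx : m x = m' x + 1 := by rw [← h]; simp
      have hm : m' = m - Pi.single x 1 := by rw [← h, add_tsub_cancel_right]
      rw [if_pos h, if_neg (by omega), if_pos hm, hx]
      push_cast; ring
    · rw [if_neg h]
      split_ifs with h0 h1
      · rfl
      · exfalso
        apply h
        rw [h1]
        refine tsub_add_cancel_of_le fun x' => ?_
        by_cases hx : x' = x
        · subst hx; simpa using Nat.one_le_iff_ne_zero.2 h0
        · simp [hx]
      · simp

/-- The unnormalised state `(∑_x â_x†)^ℓ |vac⟩`. Its weight on `|m⟩` is `ℓ!` divided by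
`√(∏ m_x!)`; the induction step is the identity `∑_x m_x = ℓ`. -/
lemma sum_cre_pow_vac_apply {n : ℕ} (ℓ : ℕ) (m : Mode n → ℕ) (hm : ∑ x, m x = ℓ) :
    ((∑ x : Mode n, cre x) ^ ℓ) (vac n) m
      = ((ℓ.factorial / √(∏ x, (m x).factorial : ℕ) : ℝ) : ℂ) := by
  induction ℓ generalizing m with
  | zero =>
    have h0 : m = 0 := by
      funext x
      exact (Finset.sum_eq_zero_iff.1 hm) x (Finset.mem_univ x)
    subst h0
    simp [vac]
  | succ ℓ ih =>
    rw [pow_succ', Module.End.mul_apply, LinearMap.sum_apply, Finsupp.finsetSum_apply]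
    have hterm : ∀ x : Mode n, cre x (((∑ x : Mode n, cre x) ^ ℓ) (vac n)) m
        = ((m x * (ℓ.factorial / √(∏ x, (m x).factorial : ℕ)) : ℝ) : ℂ) := by
      intro x
      rw [cre_apply]
      split_ifs with h0
      · simp [h0]
      · have hle : (Pi.single x 1 : Mode n → ℕ) ≤ m := fun x' => by
          by_cases hx : x' = x
          · subst hx; simpa using Nat.one_le_iff_ne_zero.2 h0
          · simp [hx]
        set m' : Mode n → ℕ := m - Pi.single x 1 with hm'
        have hmm' : m = m' + Pi.single x 1 := (tsub_add_cancel_of_le hle).symm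
        have hs : ∑ x, m' x = ℓ := by
          have : ∑ x, m x = ∑ x, m' x + 1 := by
            rw [hmm']; simp [Finset.sum_add_distrib]
          omega
        have hx : m x = m' x + 1 := by rw [hmm']; simp
        have hf : ∏ x, (m x).factorial = m x * ∏ x, (m' x).factorial := by
          rw [← Finset.mul_prod_erase _ _ (Finset.mem_univ x),
            ← Finset.mul_prod_erase _ (fun x => (m' x).factorial) (Finset.mem_univ x), ← mul_assoc]
          congr 1
          · rw [hx, Nat.factorial_succ]
          · refine Finset.prod_congr rfl fun x' hx' => ?_
            rw [hmm']
            simp [(Finset.mem_erase.1 hx').1]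
        rw [ih m' hs, ← Complex.ofReal_mul, hf]
        congr 1
        push_cast
        rw [Real.sqrt_mul (by positivity)]
        have hp : (0 : ℝ) < m x := by exact_mod_cast Nat.pos_of_ne_zero h0
        have hq : 0 < √(m x : ℝ) := Real.sqrt_pos.2 hp
        have hq2 : √(m x : ℝ) * √(m x : ℝ) = m x := Real.mul_self_sqrt hp.le
        have hr : 0 < √(∏ x, ((m' x).factorial : ℝ)) :=
          Real.sqrt_pos.2 (Finset.prod_pos fun x _ => by positivity)
        field_simp
        nlinarith
    simp only [hterm]
    rw [← Complex.ofReal_sum, ← Finset.sum_mul, ← Nat.cast_sum, hm, Nat.factorial_succ]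
    congr 1
    push_cast; ring

lemma norm_initS_sq {n ℓ : ℕ} (m : RegS n ℓ) :
    ‖initS n ℓ m‖ ^ 2 = Nat.multinomial Finset.univ m.1 / (2 ^ n : ℝ) ^ ℓ := by
  have h : creMom (0 : Mode n) = (1 / ((√(2 ^ n) : ℝ) : ℂ)) • ∑ x : Mode n, cre x := by
    simp [creMom, sgn]
  rw [initS, h, smul_pow, LinearMap.smul_apply, Finsupp.smul_apply, Finsupp.smul_apply,
    sum_cre_pow_vac_apply ℓ m.1 m.2, smul_eq_mul, smul_eq_mul, norm_mul, norm_mul, norm_pow,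
    norm_div, norm_div, norm_one, Complex.norm_real, Complex.norm_real, Complex.norm_real,
    Real.norm_of_nonneg (Real.sqrt_nonneg _), Real.norm_of_nonneg (Real.sqrt_nonneg _),
    Real.norm_of_nonneg (by positivity), mul_pow, mul_pow, div_pow, div_pow,
    Real.sq_sqrt (by positivity), div_pow, ← pow_mul (√(2 ^ n)), mul_comm ℓ 2,
    pow_mul (√(2 ^ n)), Real.sq_sqrt (by positivity), div_pow, Real.sq_sqrt (by positivity)]
  have hspec := Nat.multinomial_spec Finset.univ m.1
  rw [m.2] at hspec
  have hspec' : (((∏ x, (m.1 x).factorial : ℕ) : ℝ)) * Nat.multinomial Finset.univ m.1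
      = ℓ.factorial := by exact_mod_cast hspec
  have hpos : (0 : ℝ) < ((∏ x, (m.1 x).factorial : ℕ) : ℝ) := by
    exact_mod_cast Finset.prod_pos fun x _ => Nat.factorial_pos _
  rw [← hspec']
  have hM : (0 : ℝ) < Nat.multinomial Finset.univ m.1 := by
    have : (0 : ℝ) < ℓ.factorial := by positivity
    rw [← hspec'] at this
    exact pos_of_mul_pos_right this hpos.le
  field_simp
  simp

/-- The generating function of the position distribution of the initial state: `ℓ` independent
uniformly distributed bosons. -/
lemma sum_norm_initS_sq_mul_prod_pow (n ℓ : ℕ) (t : Mode n → ℝ) :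
    ∑ m : RegS n ℓ, ‖initS n ℓ m‖ ^ 2 * ∏ x, t x ^ m.1 x = ((∑ x, t x) / 2 ^ n) ^ ℓ := by
  rw [div_pow, Finset.sum_pow_eq_sum_piAntidiag, Finset.sum_div,
    Finset.sum_subtype (p := fun m : Mode n → ℕ => ∑ x, m x = ℓ) _ (by simp)]
  refine Finset.sum_congr rfl fun m _ => ?_
  rw [norm_initS_sq]
  ring

lemma sum_norm_initS_sq (n ℓ : ℕ) : ∑ m : RegS n ℓ, ‖initS n ℓ m‖ ^ 2 = 1 := by
  have h := sum_norm_initS_sq_mul_prod_pow n ℓ 1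
  simpa [ZMod.card] using h

lemma sum_exp_sgnR {n : ℕ} {y : Mode n} (hy : y ≠ 0) (s : ℝ) :
    ∑ x, Real.exp (s * sgnR x y) = 2 ^ n * Real.cosh s := by
  have h : ∀ x : Mode n, Real.exp (s * sgnR x y) = Real.cosh s + sgnR x y * Real.sinh s := by
    intro x
    rcases sgnR_eq_one_or x y with h | h <;> rw [h]
    · rw [mul_one, one_mul, Real.cosh_add_sinh]
    · rw [mul_neg_one, neg_one_mul, ← sub_eq_add_neg, Real.cosh_sub_sinh]
  simp only [h, Finset.sum_add_distrib]
  rw [← Finset.sum_mul, sum_sgnR, if_neg hy]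
  simp [ZMod.card]

/-- Sub-Gaussian bound on the eigenvalues of `G̃_y` in the initial state. -/
lemma sum_norm_initS_sq_mul_exp_le {n ℓ : ℕ} (hℓ : 0 < ℓ) {y : Mode n} (hy : y ≠ 0) (u : ℝ) :
    ∑ m : RegS n ℓ, ‖initS n ℓ m‖ ^ 2 * Real.exp (u * ((∑ x, sgnR x y * m.1 x) / √ℓ))
      ≤ Real.exp (u ^ 2 / 2) := by
  have h := sum_norm_initS_sq_mul_prod_pow n ℓ fun x => Real.exp (u / √ℓ * sgnR x y)
  rw [sum_exp_sgnR hy, mul_div_cancel_left₀ _ (by positivity)] at h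
  have hl : (0 : ℝ) < ℓ := by exact_mod_cast hℓ
  calc _ = ∑ m : RegS n ℓ, ‖initS n ℓ m‖ ^ 2 * ∏ x, Real.exp (u / √ℓ * sgnR x y) ^ m.1 x := by
        refine Finset.sum_congr rfl fun m _ => ?_
        congr 1
        simp only [← Real.exp_nat_mul]
        rw [← Real.exp_sum]
        congr 1
        rw [Finset.sum_div, Finset.mul_sum]
        exact Finset.sum_congr rfl fun x _ => by ring
    _ = Real.cosh (u / √ℓ) ^ ℓ := h
    _ ≤ Real.exp ((u / √ℓ) ^ 2 / 2) ^ ℓ := by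
        gcongr
        exact Real.cosh_le_exp_half_sq _
    _ = Real.exp (u ^ 2 / 2) := by
        rw [← Real.exp_nat_mul, div_pow, Real.sq_sqrt hl.le]
        congr 1
        field_simp

/-- Moments of `G̃_y²` in the initial state, from the exponential moments by optimising the bound
`t ^ (2 a) ≤ (2 a)! (exp (u t) + exp (-u t)) / u ^ (2 a)` at `u² = 2 a`. -/
lemma sum_norm_initS_sq_mul_hopEig_pow_le {n ℓ : ℕ} (hℓ : 0 < ℓ) {y : Mode n} (hy : y ≠ 0)
    {a : ℕ} (ha : 0 < a) :
    ∑ m : RegS n ℓ, ‖initS n ℓ m‖ ^ 2 * hopEig ℓ y m.1 ^ a ≤ 2 * (2 * a * Real.exp 1) ^ a := by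
  have ha' : (0 : ℝ) < a := by exact_mod_cast ha
  set u : ℝ := √(2 * a) with hu
  have hu2 : u ^ 2 = 2 * a := Real.sq_sqrt (by positivity)
  have hpt : ∀ t : ℝ, (t ^ 2) ^ a ≤ (2 * a) ^ a * (Real.exp (u * t) + Real.exp (-u * t)) := by
    intro t
    have h1 := Real.pow_div_factorial_le_exp |u * t| (abs_nonneg _) (2 * a)
    have h2 : Real.exp |u * t| ≤ Real.exp (u * t) + Real.exp (-u * t) := by
      rw [neg_mul]
      rcases abs_cases (u * t) with ⟨h, -⟩ | ⟨h, -⟩ <;> rw [h]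
      · linarith [Real.exp_pos (-(u * t))]
      · linarith [Real.exp_pos (u * t)]
    have h3 : ((2 * a).factorial : ℝ) ≤ (2 * a) ^ (2 * a) := by
      exact_mod_cast Nat.factorial_le_pow (2 * a)
    rw [pow_mul, sq_abs, mul_pow u t, hu2, mul_pow, div_le_iff₀ (by positivity)] at h1
    have h4 : (2 * (a : ℝ)) ^ a * (t ^ 2) ^ a
        ≤ (2 * a) ^ a * ((2 * a) ^ a * (Real.exp (u * t) + Real.exp (-u * t))) := by
      calc _ ≤ Real.exp |u * t| * (2 * a).factorial := h1
        _ ≤ (Real.exp (u * t) + Real.exp (-u * t)) * (2 * a) ^ (2 * a) := by gcongr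
        _ = _ := by rw [two_mul a, pow_add]; ring
    exact le_of_mul_le_mul_left h4 (by positivity)
  have e1 := sum_norm_initS_sq_mul_exp_le hℓ hy u
  have e2 := sum_norm_initS_sq_mul_exp_le hℓ hy (-u)
  rw [neg_sq] at e2
  rw [hu2, mul_div_cancel_left₀ _ two_ne_zero] at e1 e2
  calc _ ≤ ∑ m : RegS n ℓ, ‖initS n ℓ m‖ ^ 2 * ((2 * a) ^ a *
        (Real.exp (u * ((∑ x, sgnR x y * m.1 x) / √ℓ))
          + Real.exp (-u * ((∑ x, sgnR x y * m.1 x) / √ℓ)))) := by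
        refine Finset.sum_le_sum fun m _ => ?_
        gcongr
        have := hpt ((∑ x, sgnR x y * m.1 x) / √ℓ)
        rwa [div_pow, Real.sq_sqrt (by positivity)] at this
    _ = (2 * a) ^ a * (∑ m : RegS n ℓ, ‖initS n ℓ m‖ ^ 2 *
          Real.exp (u * ((∑ x, sgnR x y * m.1 x) / √ℓ))
        + ∑ m : RegS n ℓ, ‖initS n ℓ m‖ ^ 2 *
          Real.exp (-u * ((∑ x, sgnR x y * m.1 x) / √ℓ))) := by
        rw [← Finset.sum_add_distrib, Finset.mul_sum]
        exact Finset.sum_congr rfl fun m _ => by ring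
    _ ≤ (2 * a) ^ a * (Real.exp a + Real.exp a) := by gcongr
    _ = 2 * (2 * a * Real.exp 1) ^ a := by
        rw [mul_pow (2 * (a : ℝ)), ← Real.exp_nat_mul, mul_one]; ring

/-! ### Ordered products along a path of queries -/

lemma reverse_prod_ofFn_succ {R : Type*} [Monoid R] {k : ℕ} (g : Fin (k + 1) → R) :
    (List.ofFn g).reverse.prod = (List.ofFn fun i : Fin k => g i.succ).reverse.prod * g 0 := by
  rw [List.ofFn_succ, List.reverse_cons, List.prod_append, List.prod_singleton]

/-- Expansion of an ordered product of sums. -/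
lemma sum_reverse_prod_ofFn {R β : Type*} [Semiring R] [Fintype β] {k : ℕ}
    (g : Fin k → β → R) :
    ∑ x : Fin k → β, (List.ofFn fun i => g i (x i)).reverse.prod
      = (List.ofFn fun i => ∑ b, g i b).reverse.prod := by
  induction k with
  | zero => simp
  | succ k ih =>
    rw [reverse_prod_ofFn_succ, ← ih fun i => g i.succ,
      ← Equiv.sum_comp (Fin.consEquiv fun _ => β), Fintype.sum_prod_type_right, Finset.sum_mul]
    refine Finset.sum_congr rfl fun x _ => ?_
    rw [Finset.mul_sum]
    refine Finset.sum_congr rfl fun b _ => ?_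
    rw [reverse_prod_ofFn_succ]
    simp [Fin.consEquiv]

lemma reverse_prod_ofFn_smul {R M : Type*} [CommMonoid R] [Monoid M] [MulAction R M]
    [IsScalarTower R M M] [SMulCommClass R M M] {k : ℕ} (c : Fin k → R) (g : Fin k → M) :
    (List.ofFn fun i => c i • g i).reverse.prod = (∏ i, c i) • (List.ofFn g).reverse.prod := by
  induction k with
  | zero => simp
  | succ k ih =>
    rw [reverse_prod_ofFn_succ, reverse_prod_ofFn_succ, ih, smul_mul_smul_comm,
      Fin.prod_univ_succ, mul_comm]

lemma kronecker_reverse_prod_ofFn {ι κ : Type*} [Fintype ι] [Fintype κ] [DecidableEq ι]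
    [DecidableEq κ] {k : ℕ} (A : Fin k → Matrix ι ι ℂ) (B : Fin k → Matrix κ κ ℂ) :
    (List.ofFn A).reverse.prod ⊗ₖ (List.ofFn B).reverse.prod
      = (List.ofFn fun i => A i ⊗ₖ B i).reverse.prod := by
  induction k with
  | zero => simp
  | succ k ih =>
    rw [reverse_prod_ofFn_succ, reverse_prod_ofFn_succ, reverse_prod_ofFn_succ,
      Matrix.mul_kronecker_mul, ih]

/-- The tuple of active query points lists `y` along the active positions in increasing order. -/
lemma ofFn_activeTuple {n T : ℕ} (y : Fin T → Mode n) (b : Fin T → Fin 2) :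
    List.ofFn (activeTuple y b) = ((List.finRange T).filter fun i => b i = 1).map y := by
  have h : (active b).sort = (List.finRange T).filter fun i => b i = 1 := by
    refine (Finset.sortedLT_sort _).eq_of_mem_iff ?_ (by simp [active])
    exact ((List.sortedLT_finRange T).pairwise.filter _).sortedLT
  rw [← h]
  refine List.ext_getElem (by simp) fun i h1 h2 => ?_
  simp [activeTuple, Finset.orderEmbOfFin_apply]

lemma reverse_prod_ofFn_activeTuple {M : Type*} [Monoid M] {n T : ℕ} (Q : Mode n → M)
    (y : Fin T → Mode n) (b : Fin T → Fin 2) :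
    (List.ofFn fun i => Q (activeTuple y b i)).reverse.prod
      = (List.ofFn fun i => if b i = 1 then Q (y i) else 1).reverse.prod := by
  have h : (List.ofFn fun i => Q (activeTuple y b i)) = (List.ofFn (activeTuple y b)).map Q := by
    rw [List.map_ofFn]; rfl
  rw [h, ofFn_activeTuple, List.ofFn_eq_map]
  induction List.finRange T with
  | nil => simp
  | cons i L ih =>
    simp only [List.map_cons, List.reverse_cons, List.prod_append, List.prod_singleton, ← ih]
    by_cases hi : b i = 1 <;> simp [hi]

/-! ### The state as a power of a one-query operator -/

/-- The operator `c Z + s X` on the qubit `U_y`. -/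
def qubitOp {n : ℕ} (c s : ℝ) (y : Mode n) : Matrix (RegU n) (RegU n) ℂ :=
  (c : ℂ) • pauliZ y + (s : ℂ) • pauliX y

/-- The action on `U` of a query with control bit `b` at the point `y`, in the sector where `G̃_y²`
has the eigenvalue `γ y`. Active queries at `0` are given the value zero. -/
def queryOp {n : ℕ} (f : Fin 2 → ℝ → ℝ) (γ : Mode n → ℝ) (b : Fin 2) (y : Mode n) :
    Matrix (RegU n) (RegU n) ℂ :=
  if b = 1 then if y = 0 then 0 else qubitOp (f 0 (γ y)) (f 1 (γ y)) y else 1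

/-- The controlled query `∑_{y,b} |b,y⟩⟨b,y| ⊗ queryOp f γ b y`. -/
def ctrlQuery {n : ℕ} (w : ℕ) (f : Fin 2 → ℝ → ℝ) (γ : Mode n → ℝ) :
    Matrix (RegA n w × RegU n) (RegA n w × RegU n) ℂ :=
  ∑ y : Mode n, ∑ b : Fin 2, proj b y ⊗ₖ queryOp f γ b y

/-- `A|0⟩ ⊗ |⊥⟩^{⊗ 2^n}`. -/
def startAU {n w : ℕ} (A : Matrix (RegA n w) (RegA n w) ℂ) : RegA n w × RegU n → ℂ :=
  fun a => A.mulVec (ketZero n w) a.1 * initU n a.2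

lemma kronecker_mulVec_mul {ι κ : Type*} [Fintype ι] [Fintype κ] (P : Matrix ι ι ℂ)
    (Q : Matrix κ κ ℂ) (u : ι → ℂ) (v : κ → ℂ) (a : ι × κ) :
    (P ⊗ₖ Q).mulVec (fun a => u a.1 * v a.2) a = P.mulVec u a.1 * Q.mulVec v a.2 := by
  simp only [Matrix.mulVec, dotProduct, Matrix.kroneckerMap_apply, Fintype.sum_prod_type,
    Finset.sum_mul_sum]
  exact Finset.sum_congr rfl fun i _ => Finset.sum_congr rfl fun j _ => by ring

/-- In the sector of a fixed position configuration `m`, a family of diagonal operators acts by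
scalars. -/
lemma kronecker_sum_diagonal_mulVec {n w ℓ : ℕ} {X : Type*} [Fintype X]
    (A P : Matrix (RegA n w) (RegA n w) ℂ) (K : X → Matrix (RegU n) (RegU n) ℂ)
    (d : X → RegS n ℓ → ℂ) (a : RegA n w × RegU n × RegS n ℓ) :
    (P ⊗ₖ ∑ x, K x ⊗ₖ Matrix.diagonal (d x)).mulVec (startVec ℓ A) a
      = initS n ℓ a.2.2 *
        (P ⊗ₖ ∑ x, d x a.2.2 • K x).mulVec (startAU A) (a.1, a.2.1) := by
  have h1 := kronecker_mulVec_mul P (∑ x, K x ⊗ₖ Matrix.diagonal (d x)) (A.mulVec (ketZero n w))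
    (fun c : RegU n × RegS n ℓ => initU n c.1 * initS n ℓ c.2) a
  have h2 := kronecker_mulVec_mul P (∑ x, d x a.2.2 • K x) (A.mulVec (ketZero n w)) (initU n)
    (a.1, a.2.1)
  refine h1.trans (Eq.trans ?_ (congrArg (initS n ℓ a.2.2 * ·) h2).symm)
  dsimp only
  rw [mul_left_comm]
  congr 1
  rw [Matrix.sum_mulVec, Matrix.sum_mulVec, Finset.sum_apply, Finset.sum_apply, Finset.mul_sum]
  refine Finset.sum_congr rfl fun x _ => ?_
  rw [kronecker_mulVec_mul, Matrix.mulVec_diagonal, Matrix.smul_mulVec, Pi.smul_apply, smul_eq_mul]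
  ring

/-- The sum over all Kraus labels of a product family factorises along the path. -/
lemma sum_smul_opKs {n k : ℕ} (f : Fin 2 → ℝ → ℝ) (γ : Mode n → ℝ) (y : Fin k → Mode n) :
    ∑ x : Fin k → Fin 2, (∏ i, (f (x i) (γ (y i)) : ℂ)) • opKs x y
      = (List.ofFn fun i => qubitOp (f 0 (γ (y i))) (f 1 (γ (y i))) (y i)).reverse.prod := by
  simp only [opKs, ← reverse_prod_ofFn_smul]
  rw [sum_reverse_prod_ofFn fun i (x : Fin 2) => (f x (γ (y i)) : ℂ) • opK x (y i)]
  simp [Fin.sum_univ_two, qubitOp, opK]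

/-- Terms with an active query at `0` vanish, for either family of functions, because the algorithm
does not query at `0`; on the other terms the truncated `queryOp` is the true query operator. -/
lemma pathOp_kronecker_queryOp_mulVec {n w T : ℕ} {A : Matrix (RegA n w) (RegA n w) ℂ}
    (hA : NeverQueriesZero T A) (f : Fin 2 → ℝ → ℝ) (γ : Mode n → ℝ) (y : Fin T → Mode n)
    (b : Fin T → Fin 2) :
    (pathOp A y b ⊗ₖ ∑ x : Fin (active b).card → Fin 2,
        (∏ i, (f (x i) (γ (activeTuple y b i)) : ℂ)) • opKs x (activeTuple y b)).mulVec (startAU A)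
      = (List.ofFn fun i => (A * proj (b i) (y i)) ⊗ₖ queryOp f γ (b i) (y i)).reverse.prod.mulVec
        (startAU A) := by
  rw [← kronecker_reverse_prod_ofFn]
  by_cases h : ∃ i, b i = 1 ∧ y i = 0
  · have h0 : ∀ Q : Matrix (RegU n) (RegU n) ℂ,
        (pathOp A y b ⊗ₖ Q).mulVec (startAU A) = 0 := by
      intro Q
      funext a
      have := kronecker_mulVec_mul (pathOp A y b) Q (A.mulVec (ketZero n w)) (initU n) a
      rw [hA y b h] at this
      exact this.trans (by simp)
    rw [h0]
    exact (h0 _).symm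
  · push Not at h
    rw [sum_smul_opKs, reverse_prod_ofFn_activeTuple
      (fun y => qubitOp (f 0 (γ y)) (f 1 (γ y)) y)]
    congr 5
    funext i
    rw [queryOp]
    split_ifs with h1 h2
    · exact absurd h2 (h i h1)
    · rfl
    · rfl

/-- For a family of product form the sum over all paths is the `T`-th power of the algorithm's
unitary times the controlled query, in each sector of fixed position configuration. -/
theorem stateOf_apply {n w ℓ T : ℕ} {A : Matrix (RegA n w) (RegA n w) ℂ}
    (hA : NeverQueriesZero T A)
    (F : (k : ℕ) → (Fin k → Fin 2) → (Fin k → Mode n) → Matrix (RegS n ℓ) (RegS n ℓ) ℂ)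
    (f : Fin 2 → ℝ → ℝ)
    (hF : ∀ k x y, F k x y = Matrix.diagonal fun m : RegS n ℓ =>
      ∏ i, (f (x i) (hopEig ℓ (y i) m.1) : ℂ))
    (a : RegA n w × RegU n × RegS n ℓ) :
    stateOf ℓ T A F a = initS n ℓ a.2.2 *
      (((A ⊗ₖ (1 : Matrix (RegU n) (RegU n) ℂ)) *
        ctrlQuery w f fun y => hopEig ℓ y a.2.2.1) ^ T).mulVec (startAU A) (a.1, a.2.1) := by
  set γ : Mode n → ℝ := fun y => hopEig ℓ y a.2.2.1 with hγ
  have hpow : ((A ⊗ₖ (1 : Matrix (RegU n) (RegU n) ℂ)) * ctrlQuery w f γ) ^ T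
      = ∑ y : Fin T → Mode n, ∑ b : Fin T → Fin 2,
        (List.ofFn fun i => (A * proj (b i) (y i)) ⊗ₖ queryOp f γ (b i) (y i)).reverse.prod := by
    have h1 : ∀ y : Fin T → Mode n, ∑ b : Fin T → Fin 2,
        (List.ofFn fun i => (A * proj (b i) (y i)) ⊗ₖ queryOp f γ (b i) (y i)).reverse.prod
        = (List.ofFn fun i => ∑ b : Fin 2,
          (A * proj b (y i)) ⊗ₖ queryOp f γ b (y i)).reverse.prod := fun y =>
      sum_reverse_prod_ofFn fun i b => (A * proj b (y i)) ⊗ₖ queryOp f γ b (y i)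
    simp only [h1]
    rw [sum_reverse_prod_ofFn fun (_ : Fin T) (y : Mode n) => ∑ b : Fin 2,
      (A * proj b y) ⊗ₖ queryOp f γ b y, List.ofFn_const, List.reverse_replicate,
      List.prod_replicate, ctrlQuery, Finset.mul_sum]
    congr 1
    refine Finset.sum_congr rfl fun y _ => ?_
    rw [Finset.mul_sum]
    refine Finset.sum_congr rfl fun b _ => ?_
    rw [← Matrix.mul_kronecker_mul, one_mul]
  rw [hpow, stateOf]
  simp only [hF]
  rw [Finset.sum_apply, Matrix.sum_mulVec, Finset.sum_apply, Finset.mul_sum]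
  refine Finset.sum_congr rfl fun y _ => ?_
  rw [Finset.sum_apply, Matrix.sum_mulVec, Finset.sum_apply, Finset.mul_sum]
  refine Finset.sum_congr rfl fun b _ => ?_
  rw [← pathOp_kronecker_queryOp_mulVec hA]
  exact kronecker_sum_diagonal_mulVec A (pathOp A y b) (fun x => opKs x (activeTuple y b)) _ a

/-! ### Operator norm bounds -/

open scoped Matrix.Norms.L2Operator

lemma pauliZ_mul_self {n : ℕ} (y : Mode n) : pauliZ y * pauliZ y = 1 := by
  rw [pauliZ, Matrix.diagonal_mul_diagonal, ← Matrix.diagonal_one]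
  congr 1
  funext u
  rw [← mul_pow]; simp

lemma update_flip_involutive {n : ℕ} (y : Mode n) (u : RegU n) :
    Function.update (Function.update u y (1 - u y)) y
      (1 - Function.update u y (1 - u y) y) = u := by
  simp

lemma eq_update_flip_comm {n : ℕ} (y : Mode n) (u u' : RegU n) :
    u = Function.update u' y (1 - u' y) ↔ u' = Function.update u y (1 - u y) := by
  constructor <;> (rintro rfl; exact (update_flip_involutive y _).symm)

lemma mul_pauliX_apply {n : ℕ} (y : Mode n) (M : Matrix (RegU n) (RegU n) ℂ) (u u' : RegU n) :
    (M * pauliX y) u u' = M u (Function.update u' y (1 - u' y)) := by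
  simp [Matrix.mul_apply, pauliX]

lemma pauliX_mul_self {n : ℕ} (y : Mode n) : pauliX y * pauliX y = 1 := by
  ext u u'
  rw [mul_pauliX_apply, pauliX, Matrix.of_apply, update_flip_involutive, Matrix.one_apply]

lemma pauliZ_mul_pauliX_add {n : ℕ} (y : Mode n) :
    pauliZ y * pauliX y + pauliX y * pauliZ y = 0 := by
  ext u u'
  rw [Matrix.add_apply, pauliZ, Matrix.diagonal_mul, Matrix.mul_diagonal, pauliX, Matrix.of_apply]
  split_ifs with h
  · have hu : u y = 1 - u' y := by rw [h]; simp
    have : ∀ a : Fin 2, (-1 : ℂ) ^ (1 - a).val + (-1) ^ a.val = 0 := by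
      intro a; fin_cases a <;> simp
    rw [hu, mul_one, one_mul, this]; rfl
  · simp

lemma qubitOp_conjTranspose {n : ℕ} (c s : ℝ) (y : Mode n) :
    (qubitOp c s y).conjTranspose = qubitOp c s y := by
  ext u u'
  rw [Matrix.conjTranspose_apply]
  simp only [qubitOp, Matrix.add_apply, Matrix.smul_apply, pauliZ, pauliX, Matrix.of_apply,
    Matrix.diagonal_apply, smul_eq_mul, eq_update_flip_comm y u' u]
  by_cases h : u = u'
  · subst h
    split_ifs <;> simp
  · rw [if_neg h, if_neg (Ne.symm h)]
    split_ifs <;> simp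

lemma qubitOp_mul_self {n : ℕ} (c s : ℝ) (y : Mode n) :
    qubitOp c s y * qubitOp c s y = ((c ^ 2 + s ^ 2 : ℝ) : ℂ) • 1 := by
  have h := pauliZ_mul_pauliX_add y
  rw [qubitOp, add_mul, mul_add, mul_add, smul_mul_smul_comm, smul_mul_smul_comm,
    smul_mul_smul_comm, smul_mul_smul_comm, pauliZ_mul_self, pauliX_mul_self,
    mul_comm (s : ℂ) (c : ℂ), add_assoc, ← add_assoc (((c : ℂ) * s) • (pauliZ y * pauliX y)),
    ← smul_add, h, smul_zero, zero_add, ← add_smul]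
  congr 1
  push_cast; ring

/-- As `Z` and `X` anticommute, `c Z + s X` has norm `√(c² + s²)`. -/
lemma norm_qubitOp_sq_le {n : ℕ} (c s : ℝ) (y : Mode n) : ‖qubitOp c s y‖ ^ 2 ≤ c ^ 2 + s ^ 2 := by
  rw [pow_two, ← Matrix.l2_opNorm_conjTranspose_mul_self, qubitOp_conjTranspose, qubitOp_mul_self,
    norm_smul, norm_one, mul_one, Complex.norm_real, Real.norm_of_nonneg (by positivity)]

lemma norm_qubitOp_le {n : ℕ} (c s : ℝ) (y : Mode n) : ‖qubitOp c s y‖ ≤ |c| + |s| := by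
  refine (sq_le_sq₀ (norm_nonneg _) (by positivity)).1 ((norm_qubitOp_sq_le c s y).trans ?_)
  rw [← sq_abs c, ← sq_abs s]
  nlinarith [abs_nonneg c, abs_nonneg s]

lemma norm_queryOp_krausFun_le {n : ℕ} {γ : Mode n → ℝ} (hγ : ∀ y, 0 ≤ γ y) (b : Fin 2)
    (y : Mode n) : ‖queryOp krausFun γ b y‖ ≤ 1 := by
  rw [queryOp]
  split_ifs
  · simp
  · refine (sq_le_sq₀ (norm_nonneg _) zero_le_one).1 ((norm_qubitOp_sq_le _ _ y).trans ?_)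
    rw [krausFun_sq_add_sq (hγ y), one_pow]
  · rw [norm_one]

lemma norm_queryOp_sub_le {n : ℕ} {γ : Mode n → ℝ} (f g : Fin 2 → ℝ → ℝ) {δ : ℝ} (hδ : 0 ≤ δ)
    (h : ∀ y, y ≠ 0 → |f 0 (γ y) - g 0 (γ y)| + |f 1 (γ y) - g 1 (γ y)| ≤ δ) (b : Fin 2)
    (y : Mode n) : ‖queryOp f γ b y - queryOp g γ b y‖ ≤ δ := by
  rw [queryOp, queryOp]
  split_ifs with hb hy
  · simpa using hδ
  · have e : qubitOp (f 0 (γ y)) (f 1 (γ y)) y - qubitOp (g 0 (γ y)) (g 1 (γ y)) y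
        = qubitOp (f 0 (γ y) - g 0 (γ y)) (f 1 (γ y) - g 1 (γ y)) y := by
      simp only [qubitOp, Complex.ofReal_sub, sub_smul]; abel
    rw [e]
    exact (norm_qubitOp_le _ _ y).trans (h y hy)
  · simpa using hδ

lemma sum_proj_kronecker_apply {n w : ℕ} (Q : Fin 2 → Mode n → Matrix (RegU n) (RegU n) ℂ)
    (v : RegA n w × RegU n → ℂ) (a : RegA n w) (u : RegU n) :
    (∑ y : Mode n, ∑ b : Fin 2, (proj b y : Matrix (RegA n w) (RegA n w) ℂ) ⊗ₖ Q b y).mulVec v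
      (a, u) = (Q a.1 a.2.1).mulVec (fun u => v (a, u)) u := by
  have hM : ∀ c : RegA n w × RegU n,
      (∑ y : Mode n, ∑ b : Fin 2, (proj b y : Matrix (RegA n w) (RegA n w) ℂ) ⊗ₖ Q b y) (a, u) c
        = if a = c.1 then Q a.1 a.2.1 u c.2 else 0 := by
    intro c
    rw [Matrix.sum_apply, Finset.sum_eq_single a.2.1]
    · rw [Matrix.sum_apply, Finset.sum_eq_single a.1]
      · simp [proj, Matrix.diagonal_apply]
      · intro b _ hb
        simp [proj, Matrix.diagonal_apply, Ne.symm hb]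
      · simp
    · intro y _ hy
      rw [Matrix.sum_apply]
      exact Finset.sum_eq_zero fun b _ => by simp [proj, Matrix.diagonal_apply, Ne.symm hy]
    · simp
  simp only [Matrix.mulVec, dotProduct, hM, ite_mul, zero_mul]
  rw [Fintype.sum_prod_type, Finset.sum_eq_single a]
  · simp
  · intro c _ hc
    simp [Ne.symm hc]
  · simp

lemma norm_sum_proj_kronecker_le {n w : ℕ} (Q : Fin 2 → Mode n → Matrix (RegU n) (RegU n) ℂ)
    {c : ℝ} (hc : 0 ≤ c) (hQ : ∀ b y, ‖Q b y‖ ≤ c) :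
    ‖∑ y : Mode n, ∑ b : Fin 2, (proj b y : Matrix (RegA n w) (RegA n w) ℂ) ⊗ₖ Q b y‖ ≤ c := by
  rw [← Matrix.l2_opNorm_toEuclideanCLM]
  refine ContinuousLinearMap.opNorm_le_bound _ hc fun v => ?_
  refine (sq_le_sq₀ (norm_nonneg _) (by positivity)).1 ?_
  have hs : ∀ F : RegA n w × RegU n → ℝ, ∑ a, F a = ∑ a, ∑ u, F (a, u) := fun F =>
    Fintype.sum_prod_type F
  rw [mul_pow, EuclideanSpace.norm_sq_eq, EuclideanSpace.norm_sq_eq, hs, hs, Finset.mul_sum]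
  refine Finset.sum_le_sum fun a _ => ?_
  have h1 := Matrix.l2_opNorm_mulVec (Q a.1 a.2.1)
    (WithLp.toLp 2 fun u => v (a, u) : EuclideanSpace ℂ (RegU n))
  have h2 := h1.trans (mul_le_mul_of_nonneg_right (hQ a.1 a.2.1) (norm_nonneg _))
  have h3 := pow_le_pow_left₀ (norm_nonneg _) h2 2
  rw [mul_pow, EuclideanSpace.norm_sq_eq, EuclideanSpace.norm_sq_eq] at h3
  refine le_trans (le_of_eq ?_) h3
  refine Finset.sum_congr rfl fun u _ => ?_
  have := sum_proj_kronecker_apply (w := w) Q v.ofLp a u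
  congr 2

/-- Telescoping for powers of a contraction and of a `δ`-perturbation of it. -/
lemma norm_pow_sub_pow_le {E : Type*} [NormedRing E] [NormOneClass E] (x y : E) {δ : ℝ}
    (hx : ‖x‖ ≤ 1) (hxy : ‖y - x‖ ≤ δ) (T : ℕ) : ‖y ^ T - x ^ T‖ ≤ (1 + δ) ^ T - 1 := by
  have hδ : 0 ≤ δ := (norm_nonneg _).trans hxy
  have hy : ‖y‖ ≤ 1 + δ := by
    calc ‖y‖ = ‖x + (y - x)‖ := by rw [add_sub_cancel]
      _ ≤ _ := (norm_add_le _ _).trans (add_le_add hx hxy)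
  induction T with
  | zero => simp
  | succ T ih =>
    have e : y ^ (T + 1) - x ^ (T + 1) = y * (y ^ T - x ^ T) + (y - x) * x ^ T := by
      rw [pow_succ', pow_succ']; noncomm_ring
    have hxT : ‖x ^ T‖ ≤ 1 := (norm_pow_le x T).trans (pow_le_one₀ (norm_nonneg _) hx)
    have h1 : ‖y * (y ^ T - x ^ T)‖ ≤ (1 + δ) * ((1 + δ) ^ T - 1) :=
      (norm_mul_le _ _).trans (mul_le_mul hy ih (norm_nonneg _) (by positivity))
    have h2 : ‖(y - x) * x ^ T‖ ≤ δ * 1 :=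
      (norm_mul_le _ _).trans (mul_le_mul hxy hxT (norm_nonneg _) hδ)
    rw [e]
    calc _ ≤ (1 + δ) * ((1 + δ) ^ T - 1) + δ * 1 :=
          (norm_add_le _ _).trans (add_le_add h1 h2)
      _ = _ := by ring

lemma norm_startAU {n w : ℕ} {A : Matrix (RegA n w) (RegA n w) ℂ}
    (hA : A ∈ Matrix.unitaryGroup (RegA n w) ℂ) :
    ‖(WithLp.toLp 2 (startAU A) : EuclideanSpace ℂ (RegA n w × RegU n))‖ ≤ 1 := by
  have hU : A ⊗ₖ (1 : Matrix (RegU n) (RegU n) ℂ) ∈ unitary _ :=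
    Matrix.kronecker_mem_unitary hA (one_mem _)
  have h1 : startAU A = (A ⊗ₖ (1 : Matrix (RegU n) (RegU n) ℂ)).mulVec
      (Pi.single (0, 0) 1) := by
    funext a
    have e : (Pi.single (0, 0) 1 : RegA n w × RegU n → ℂ)
        = fun a => ketZero n w a.1 * initU n a.2 := by
      funext a
      simp only [Pi.single_apply, ketZero, initU, Prod.ext_iff]
      split_ifs <;> simp_all
    rw [e, kronecker_mulVec_mul, Matrix.one_mulVec]
    rfl
  have h2 := Matrix.l2_opNorm_mulVec (A ⊗ₖ (1 : Matrix (RegU n) (RegU n) ℂ))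
    (EuclideanSpace.single (0, 0) 1)
  rw [PiLp.norm_single, norm_one, mul_one, CStarRing.norm_of_mem_unitary hU] at h2
  rw [h1]
  exact h2

/-- Replacing the Kraus functions changes the `A U`-part of the state, in a fixed sector, by at most
`(1 + δ) ^ T - 1` if the functions are `δ`-close at all relevant eigenvalues. -/
lemma norm_stepOp_pow_sub_le {n w : ℕ} (T : ℕ) {A : Matrix (RegA n w) (RegA n w) ℂ}
    (hA : A ∈ Matrix.unitaryGroup (RegA n w) ℂ) {γ : Mode n → ℝ} (hγ : ∀ y, 0 ≤ γ y)
    (g : Fin 2 → ℝ → ℝ) {δ : ℝ} (hδ : 0 ≤ δ)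
    (h : ∀ y, y ≠ 0 → |krausFun 0 (γ y) - g 0 (γ y)| + |krausFun 1 (γ y) - g 1 (γ y)| ≤ δ) :
    ‖((A ⊗ₖ (1 : Matrix (RegU n) (RegU n) ℂ)) * ctrlQuery w krausFun γ) ^ T
      - ((A ⊗ₖ (1 : Matrix (RegU n) (RegU n) ℂ)) * ctrlQuery w g γ) ^ T‖ ≤ (1 + δ) ^ T - 1 := by
  have hU : A ⊗ₖ (1 : Matrix (RegU n) (RegU n) ℂ) ∈ unitary _ :=
    Matrix.kronecker_mem_unitary hA (one_mem _)
  rw [norm_sub_rev]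
  refine norm_pow_sub_pow_le _ _ ?_ ?_ T
  · rw [CStarRing.norm_mem_unitary_mul _ hU]
    exact norm_sum_proj_kronecker_le _ zero_le_one (norm_queryOp_krausFun_le hγ)
  · rw [← mul_sub, CStarRing.norm_mem_unitary_mul _ hU, norm_sub_rev]
    have e : ctrlQuery w krausFun γ - ctrlQuery w g γ
        = ∑ y : Mode n, ∑ b : Fin 2, (proj b y : Matrix (RegA n w) (RegA n w) ℂ)
          ⊗ₖ (queryOp krausFun γ b y - queryOp g γ b y) := by
      simp only [ctrlQuery, ← Finset.sum_sub_distrib]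
      refine Finset.sum_congr rfl fun y _ => Finset.sum_congr rfl fun b _ => ?_
      ext i j
      simp [mul_sub]
    rw [e]
    exact norm_sum_proj_kronecker_le _ hδ (norm_queryOp_sub_le _ _ hδ h)

/-- The sectors of different position configurations are orthogonal, so the squared distance is the
average of the sector-wise bounds over the position distribution of the initial state. -/
theorem norm_psiPQ_sub_psiPoly_sq_le {n w ℓ T : ℕ} {A : Matrix (RegA n w) (RegA n w) ℂ}
    (hA : A ∈ Matrix.unitaryGroup (RegA n w) ℂ) (hA0 : NeverQueriesZero T A)
    (p : Fin 2 → Polynomial ℝ) (δ : (Mode n → ℕ) → ℝ) (hδ : ∀ m, 0 ≤ δ m)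
    (h : ∀ m y, y ≠ 0 → |krausFun 0 (hopEig ℓ y m) - (p 0).eval (hopEig ℓ y m)|
      + |krausFun 1 (hopEig ℓ y m) - (p 1).eval (hopEig ℓ y m)| ≤ δ m) :
    ‖psiPQ ℓ T A - psiPoly ℓ T A fun _ x => prodPoly p x‖ ^ 2
      ≤ ∑ m : RegS n ℓ, ‖initS n ℓ m‖ ^ 2 * ((1 + δ m.1) ^ T - 1) ^ 2 := by
  set g : Fin 2 → ℝ → ℝ := fun b t => (p b).eval t with hg
  set W : (Fin 2 → ℝ → ℝ) → RegS n ℓ → Matrix (RegA n w × RegU n) (RegA n w × RegU n) ℂ :=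
    fun f m => ((A ⊗ₖ (1 : Matrix (RegU n) (RegU n) ℂ)) *
        ctrlQuery w f fun y => hopEig ℓ y m.1) ^ T with hW
  have hent : ∀ a : RegA n w × RegU n × RegS n ℓ,
      (psiPQ ℓ T A - psiPoly ℓ T A fun _ x => prodPoly p x) a
        = initS n ℓ a.2.2 *
          ((W krausFun a.2.2 - W g a.2.2).mulVec (startAU A)) (a.1, a.2.1) := by
    intro a
    rw [PiLp.sub_apply, psiPQ, psiPoly,
      stateOf_apply hA0 _ krausFun (fun k x y => krausOp_eq_diagonal n ℓ k x y),
      stateOf_apply hA0 _ g (fun k x y => polyOp_prodPoly_eq_diagonal n ℓ p x y),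
      ← mul_sub, Matrix.sub_mulVec]
    rfl
  rw [EuclideanSpace.norm_sq_eq]
  rw [← (Equiv.prodAssoc (RegA n w) (RegU n) (RegS n ℓ)).sum_comp, Fintype.sum_prod_type_right]
  simp only [hent, norm_mul, mul_pow, Equiv.prodAssoc_apply]
  refine Finset.sum_le_sum fun m _ => ?_
  simp only [← Finset.mul_sum]
  gcongr
  have h1 := Matrix.l2_opNorm_mulVec (W krausFun m - W g m) (WithLp.toLp 2 (startAU A))
  have h2 := h1.trans (mul_le_mul (norm_stepOp_pow_sub_le T hA (fun y => hopEig_nonneg ℓ y m.1) g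
    (hδ m.1) (h m.1)) (norm_startAU hA) (norm_nonneg _)
    (by have := one_le_pow₀ (M₀ := ℝ) (n := T) (by linarith [hδ m.1] : 1 ≤ 1 + δ m.1); linarith))
  have h3 := pow_le_pow_left₀ (norm_nonneg _) h2 2
  rw [EuclideanSpace.norm_sq_eq, mul_one] at h3
  exact h3

/-! ### Choice of the parameters -/

lemma abs_krausFun_le_one (b : Fin 2) {t : ℝ} (ht : 0 ≤ t) : |krausFun b t| ≤ 1 := by
  have h := krausFun_sq_add_sq ht
  rw [abs_le_one_iff_mul_self_le_one, ← pow_two]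
  fin_cases b
  · exact h ▸ le_add_of_nonneg_right (sq_nonneg _)
  · exact h ▸ le_add_of_nonneg_left (sq_nonneg _)

lemma one_add_pow_sub_one_le {ε : ℝ} (h0 : 0 ≤ ε) (h1 : ε ≤ 1) (T : ℕ) :
    (1 + ε) ^ T - 1 ≤ 2 ^ T * ε := by
  induction T with
  | zero => simpa using h0
  | succ T ih =>
    have h2 : (1 + ε) ^ T ≤ 2 ^ T := by gcongr; linarith
    calc (1 + ε) ^ (T + 1) - 1 = ((1 + ε) ^ T - 1) + (1 + ε) ^ T * ε := by ring
      _ ≤ 2 ^ T * ε + 2 ^ T * ε := by gcongr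
      _ = _ := by ring

/-- The squared distance in a fixed sector: either all eigenvalues are at most `R` and the uniform
approximation applies, or the largest eigenvalue `γ y > R` dominates the growth of the polynomials
at all points. -/
lemma exists_sector_bound {n D T : ℕ} (hD : 0 < D) {B R ε η : ℝ} (hB : 0 < B) (hR : 1 ≤ R)
    (hε0 : 0 ≤ ε) (hε1 : ε ≤ 1) (hη : 2 ^ T * ε ≤ η) (d : ℝ → ℝ)
    (hd1 : ∀ t, 0 ≤ t → t ≤ R → d t ≤ ε)
    (hd2 : ∀ t, R ≤ t → d t ≤ 2 + 2 * (B * (6 * t / R) ^ D))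
    (γ : Mode n → ℝ) (hγ : ∀ y, 0 ≤ γ y) :
    ∃ δ : ℝ, 0 ≤ δ ∧ (∀ y, y ≠ 0 → d (γ y) ≤ δ) ∧
      ((1 + δ) ^ T - 1) ^ 2
        ≤ η ^ 2 + ∑ y ∈ Finset.univ.filter (fun y : Mode n => y ≠ 0),
          (6 * (3 + 2 * B) / R * γ y) ^ (2 * D * T) := by
  have hR0 : 0 < R := by linarith
  set K := 6 * (3 + 2 * B) with hK
  have hK18 : 18 ≤ K := by linarith
  have hnn : ∀ y, 0 ≤ (K / R * γ y) ^ (2 * D * T) := fun y => by have := hγ y; positivity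
  have hsum : 0 ≤ ∑ y ∈ Finset.univ.filter (fun y : Mode n => y ≠ 0),
      (K / R * γ y) ^ (2 * D * T) := Finset.sum_nonneg fun y _ => hnn y
  have hgrow : ∀ t, R ≤ t → d t ≤ (K / R * t) ^ D - 1 := by
    intro t ht
    have h6 : 1 ≤ 6 * t / R := by rw [one_le_div hR0]; linarith
    have h6D : 1 ≤ (6 * t / R) ^ D := one_le_pow₀ h6
    have h3 : 3 + 2 * B ≤ (3 + 2 * B) ^ D := le_self_pow₀ (by linarith) hD.ne'
    have e : (K / R * t) ^ D = (3 + 2 * B) ^ D * (6 * t / R) ^ D := by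
      rw [← mul_pow, hK]; congr 1; ring
    have h4 : (3 + 2 * B) * (6 * t / R) ^ D ≤ (3 + 2 * B) ^ D * (6 * t / R) ^ D := by gcongr
    rw [e]
    linarith [hd2 t ht]
  by_cases hall : ∀ y, y ≠ 0 → γ y ≤ R
  · refine ⟨ε, hε0, fun y hy => hd1 _ (hγ y) (hall y hy), ?_⟩
    have h1 : 0 ≤ (1 + ε) ^ T - 1 := by
      linarith [one_le_pow₀ (M₀ := ℝ) (n := T) (by linarith : 1 ≤ 1 + ε)]
    have h2 := pow_le_pow_left₀ h1 ((one_add_pow_sub_one_le hε0 hε1 T).trans hη) 2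
    linarith
  · push Not at hall
    obtain ⟨y₀, hy₀, hy₀R⟩ := hall
    obtain ⟨z, hz, hzmax⟩ := Finset.exists_max_image (Finset.univ.filter fun y : Mode n => y ≠ 0) γ
      ⟨y₀, by simpa using hy₀⟩
    have hzR : R < γ z := hy₀R.trans_le (hzmax y₀ (by simpa using hy₀))
    set X := (K / R * γ z) ^ D with hX
    have hbase : 18 ≤ K / R * γ z := by
      rw [div_mul_eq_mul_div, le_div_iff₀ hR0]
      exact mul_le_mul hK18 hzR.le hR0.le (by linarith)
    have hX18 : 18 ≤ X := hbase.trans (le_self_pow₀ (by linarith) hD.ne')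
    refine ⟨X - 1, by linarith, fun y hy => ?_, ?_⟩
    · rcases le_or_gt (γ y) R with h | h
      · linarith [hd1 _ (hγ y) h]
      · refine (hgrow _ h.le).trans ?_
        have : γ y ≤ γ z := hzmax y (by simpa using hy)
        rw [hX]
        have := hγ y
        gcongr
    · have h1 : 1 ≤ X ^ T := one_le_pow₀ (by linarith)
      have h2 : (X ^ T) ^ 2 = (K / R * γ z) ^ (2 * D * T) := by
        rw [hX, ← pow_mul, ← pow_mul]; congr 1; ring
      have h3 := Finset.single_le_sum (f := fun y => (K / R * γ y) ^ (2 * D * T))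
        (fun y _ => hnn y) hz
      rw [← h2] at h3
      rw [add_sub_cancel]
      nlinarith [sq_nonneg η]

/-- The squared error averaged over the position distribution of the initial state. -/
lemma sum_norm_initS_sq_mul_le {n ℓ a : ℕ} (hℓ : 0 < ℓ) (ha : 0 < a) {η c : ℝ} (hc : 0 ≤ c)
    (e : (Mode n → ℕ) → ℝ)
    (he : ∀ m, e m ≤ η ^ 2 + ∑ y ∈ Finset.univ.filter (fun y : Mode n => y ≠ 0),
      (c * hopEig ℓ y m) ^ a) :
    ∑ m : RegS n ℓ, ‖initS n ℓ m‖ ^ 2 * e m.1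
      ≤ η ^ 2 + 2 ^ n * (2 * (c * (2 * a * Real.exp 1)) ^ a) := by
  calc _ ≤ ∑ m : RegS n ℓ, ‖initS n ℓ m‖ ^ 2 * (η ^ 2 +
        ∑ y ∈ Finset.univ.filter (fun y : Mode n => y ≠ 0), (c * hopEig ℓ y m.1) ^ a) := by
        gcongr with m
        exact he m.1
    _ = η ^ 2 + ∑ y ∈ Finset.univ.filter (fun y : Mode n => y ≠ 0),
        c ^ a * ∑ m : RegS n ℓ, ‖initS n ℓ m‖ ^ 2 * hopEig ℓ y m.1 ^ a := by
        simp only [mul_add, Finset.sum_add_distrib, ← Finset.sum_mul, sum_norm_initS_sq, one_mul]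
        congr 1
        simp only [Finset.mul_sum]
        rw [Finset.sum_comm]
        refine Finset.sum_congr rfl fun y _ => Finset.sum_congr rfl fun m _ => ?_
        rw [mul_pow]; ring
    _ ≤ η ^ 2 + ∑ y ∈ Finset.univ.filter (fun y : Mode n => y ≠ 0),
        c ^ a * (2 * (2 * a * Real.exp 1) ^ a) := by
        gcongr with y hy
        exact sum_norm_initS_sq_mul_hopEig_pow_le hℓ (Finset.mem_filter.1 hy).2 ha
    _ ≤ η ^ 2 + ∑ y : Mode n, c ^ a * (2 * (2 * a * Real.exp 1) ^ a) := by
        gcongr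
        exact Finset.filter_subset _ _
    _ = _ := by
        rw [Finset.sum_const, Finset.card_univ, nsmul_eq_mul, mul_pow c]
        simp [ZMod.card]
        ring

lemma two_mul_exp_neg_two_le : 2 * Real.exp (-2) ≤ 1 / 2 := by
  have he : 2 ≤ Real.exp 1 := by linarith [Real.add_one_le_exp 1]
  rw [show (-2 : ℝ) = -(1 + 1) by norm_num, Real.exp_neg, Real.exp_add, ← div_eq_mul_inv,
    div_le_iff₀ (by positivity)]
  nlinarith

/-- The degree `D`: the cut-off `R` is proportional to the total degree `a = 2 D T` so that the
`a`-th moment of `G̃_y²` beats the growth of the polynomials, and `D / √R` is the exponent of the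
uniform error on `[0, R]`. -/
lemma exists_degree {B K : ℝ} (hB : 0 < B) (hK : 18 ≤ K) {n T : ℕ} (hn : 0 < n) (hT : 0 < T)
    {L : ℝ} (hL : 1 ≤ L) : ∃ D : ℕ, 0 < D ∧
      (D : ℝ) ≤ (4 * Real.exp 1 ^ 2 * K * (8 * B + 2) ^ 2 + 7) * (n ^ 2 * T ^ 3 * L ^ 2) ∧
      n + 2 + 2 * L ≤ ((2 * D * T : ℕ) : ℝ) ∧
      1 ≤ 2 * Real.exp 1 ^ 2 * (2 * D * T : ℕ) * K ∧
      8 * B + T + L ≤ D / √(2 * Real.exp 1 ^ 2 * (2 * D * T : ℕ) * K) := by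
  have he1 : 2 ≤ Real.exp 1 := by linarith [Real.add_one_le_exp 1]
  set c₁ : ℝ := 4 * Real.exp 1 ^ 2 * K * (8 * B + 2) ^ 2 with hc₁
  have hc₁0 : 0 < c₁ := by positivity
  have hn1 : (1 : ℝ) ≤ n := by exact_mod_cast hn
  have hT1 : (1 : ℝ) ≤ T := by exact_mod_cast hT
  set q : ℝ := n ^ 2 * T ^ 3 * L ^ 2 with hq
  have hTL : 1 ≤ (T : ℝ) ^ 3 := one_le_pow₀ hT1
  have hqTL : (T : ℝ) ^ 3 * L ^ 2 ≤ q := by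
    rw [hq, mul_assoc]
    exact le_mul_of_one_le_left (by positivity) (one_le_pow₀ hn1)
  have hqL : L ≤ q :=
    ((le_self_pow₀ hL two_ne_zero).trans (le_mul_of_one_le_left (by positivity) hTL)).trans hqTL
  have hqn : (n : ℝ) ≤ q := by
    have h1 : (1 : ℝ) ≤ T ^ 3 * L ^ 2 := one_le_mul_of_one_le_of_one_le hTL (one_le_pow₀ hL)
    rw [hq, mul_assoc]
    exact (le_self_pow₀ hn1 two_ne_zero).trans (le_mul_of_one_le_right (by positivity) h1)
  have hq1 : 1 ≤ q := hL.trans hqL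
  have hDge := Nat.le_ceil ((c₁ + 6) * q)
  have hDlt := (Nat.ceil_lt_add_one (by positivity : 0 ≤ (c₁ + 6) * q)).le
  set D : ℕ := ⌈(c₁ + 6) * q⌉₊
  have hDr : (0 : ℝ) < D := lt_of_lt_of_le (by positivity) hDge
  have hD0 : 0 < D := by exact_mod_cast hDr
  have h6q : 6 * q ≤ D := le_trans (by gcongr; linarith) hDge
  have hDT : (D : ℝ) ≤ D * T := le_mul_of_one_le_right hDr.le hT1
  have hR1 : 1 ≤ 2 * Real.exp 1 ^ 2 * (2 * D * T : ℕ) * K := by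
    have h1 : 1 ≤ 2 * Real.exp 1 ^ 2 := by nlinarith
    have h2 : (1 : ℝ) ≤ (2 * D * T : ℕ) := by
      exact_mod_cast (by positivity : 0 < 2 * D * T)
    exact one_le_mul_of_one_le_of_one_le (one_le_mul_of_one_le_of_one_le h1 h2) (by linarith)
  refine ⟨D, hD0, by linarith, by push_cast; linarith, hR1, ?_⟩
  have hR0 := zero_lt_one.trans_le hR1
  rw [le_div_iff₀ (Real.sqrt_pos.2 hR0)]
  refine (sq_le_sq₀ (by positivity) hDr.le).1 ?_
  rw [mul_pow, Real.sq_sqrt hR0.le]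
  have hNle : 8 * B + T + L ≤ (8 * B + 2) * (T * L) := by
    have h1 : (1 : ℝ) ≤ T * L := one_le_mul_of_one_le_of_one_le hT1 hL
    have h2 : (T : ℝ) ≤ T * L := le_mul_of_one_le_right (by linarith) hL
    have h3 : L ≤ T * L := le_mul_of_one_le_left (by linarith) hT1
    have h4 : 8 * B ≤ 8 * B * (T * L) := le_mul_of_one_le_right (by linarith) h1
    linarith
  calc (8 * B + T + L) ^ 2 * (2 * Real.exp 1 ^ 2 * (2 * D * T : ℕ) * K)
      ≤ ((8 * B + 2) * (T * L)) ^ 2 * (2 * Real.exp 1 ^ 2 * (2 * D * T : ℕ) * K) := by gcongr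
    _ = c₁ * (T ^ 3 * L ^ 2) * D := by rw [hc₁]; push_cast; ring
    _ ≤ (c₁ + 6) * q * D := by gcongr; linarith
    _ ≤ D * D := by gcongr
    _ = (D : ℝ) ^ 2 := by ring

lemma uniform_error_le {B L s : ℝ} (hB : 0 < B) {T : ℕ} (hs : 8 * B + T + L ≤ s) :
    4 * B * Real.exp (-s) ≤ Real.exp (-L) / 2 / 2 ^ T := by
  have h1 : Real.exp (-s) ≤ Real.exp (-(8 * B)) * Real.exp (-(T : ℝ)) * Real.exp (-L) := by
    rw [← Real.exp_add, ← Real.exp_add]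
    exact Real.exp_le_exp.2 (by linarith)
  have h2 : 8 * B * Real.exp (-(8 * B)) ≤ 1 := by
    rw [Real.exp_neg, ← div_eq_mul_inv, div_le_one (Real.exp_pos _)]
    linarith [Real.add_one_le_exp (8 * B)]
  have h3 : Real.exp (-(T : ℝ)) ≤ 1 / 2 ^ T := by
    rw [Real.exp_neg, ← one_div]
    refine one_div_le_one_div_of_le (by positivity) ?_
    rw [← mul_one (T : ℝ), Real.exp_nat_mul]
    gcongr
    linarith [Real.add_one_le_exp 1]
  calc 4 * B * Real.exp (-s)
      ≤ 4 * B * (Real.exp (-(8 * B)) * Real.exp (-(T : ℝ)) * Real.exp (-L)) := by gcongr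
    _ = (8 * B * Real.exp (-(8 * B))) * Real.exp (-(T : ℝ)) * (Real.exp (-L) / 2) := by ring
    _ ≤ 1 * (1 / 2 ^ T) * (Real.exp (-L) / 2) := by gcongr
    _ = _ := by ring

lemma tail_error_le {n a : ℕ} {L : ℝ} (h : n + 2 + 2 * L ≤ (a : ℝ)) :
    2 ^ n * (2 * Real.exp (-1) ^ a) ≤ Real.exp (-L) ^ 2 / 2 := by
  rw [← Real.exp_nat_mul, ← Real.exp_nat_mul]
  have h1 : (2 : ℝ) ^ n ≤ Real.exp n := by
    rw [← mul_one (n : ℝ), Real.exp_nat_mul]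
    gcongr
    linarith [Real.add_one_le_exp 1]
  calc (2 : ℝ) ^ n * (2 * Real.exp (a * -1))
      ≤ Real.exp n * (2 * Real.exp (-(n + 2 + 2 * L))) := by
        gcongr; linarith
    _ = 2 * Real.exp (-2) * Real.exp ((2 : ℕ) * -L) := by
        rw [mul_left_comm, ← Real.exp_add, mul_assoc, ← Real.exp_add]
        congr 2; push_cast; ring
    _ ≤ 1 / 2 * Real.exp ((2 : ℕ) * -L) := by
        gcongr
        exact two_mul_exp_neg_two_le
    _ = _ := by ring

/-- One-variable polynomials of degree of order `n² T³ L²` whose products approximate the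
post-query state with error `exp (-L)`. -/
theorem exists_polynomials_norm_sub_le : ∃ c : ℝ, 0 < c ∧ ∀ (n T : ℕ) (L : ℝ), 0 < n → 0 < T →
    1 ≤ L → ∃ p : Fin 2 → Polynomial ℝ,
      (∀ b, ((p b).natDegree : ℝ) ≤ c * (n ^ 2 * T ^ 3 * L ^ 2)) ∧
      ∀ ℓ : ℕ, 0 < ℓ → ∀ (w : ℕ) (A : Matrix (RegA n w) (RegA n w) ℂ),
        A ∈ Matrix.unitaryGroup (RegA n w) ℂ → NeverQueriesZero T A →
          ‖psiPQ ℓ T A - psiPoly ℓ T A fun _ x => prodPoly p x‖ ≤ Real.exp (-L) := by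
  obtain ⟨B, hB, happ⟩ := exists_krausFun_approx
  have hK18 : 18 ≤ 6 * (3 + 2 * B) := by linarith
  refine ⟨4 * Real.exp 1 ^ 2 * (6 * (3 + 2 * B)) * (8 * B + 2) ^ 2 + 7, by positivity,
    fun n T L hn hT hL => ?_⟩
  obtain ⟨D, hD0, hDle, haL, hR1, hND⟩ := exists_degree hB hK18 hn hT hL
  have ha0 : 0 < 2 * D * T := by positivity
  generalize hR : 2 * Real.exp 1 ^ 2 * ((2 * D * T : ℕ) : ℝ) * (6 * (3 + 2 * B)) = R at hR1 hND
  have hunif := uniform_error_le hB hND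
  have hεη : (2 : ℝ) ^ T * (Real.exp (-L) / 2 / 2 ^ T) ≤ Real.exp (-L) / 2 := by
    rw [mul_div_cancel₀ _ (by positivity)]
  have hε1 : Real.exp (-L) / 2 / 2 ^ T ≤ 1 := by
    have : Real.exp (-L) ≤ 1 := Real.exp_le_one_iff.2 (by linarith)
    exact (div_le_self (by positivity) (one_le_pow₀ one_le_two)).trans (by linarith)
  choose p hpD hp1 hp2 using fun b => happ b R hR1 D
  refine ⟨p, fun b => le_trans (by exact_mod_cast hpD b) hDle, fun ℓ hℓ w A hA hA0 => ?_⟩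
  have hsector := fun m : Mode n → ℕ => exists_sector_bound (n := n) (T := T) hD0 hB hR1
    (by positivity) hε1 hεη
    (fun t => |krausFun 0 t - (p 0).eval t| + |krausFun 1 t - (p 1).eval t|)
    (fun t h0 h1 => by
      linarith [hp1 0 t h0 h1, hp1 1 t h0 h1])
    (fun t ht => by
      have h0 : 0 ≤ t := by linarith
      have k0 := (abs_sub (krausFun 0 t) ((p 0).eval t)).trans
        (add_le_add (abs_krausFun_le_one 0 h0) (hp2 0 t ht))
      have k1 := (abs_sub (krausFun 1 t) ((p 1).eval t)).trans
        (add_le_add (abs_krausFun_le_one 1 h0) (hp2 1 t ht))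
      linarith)
    (fun y => hopEig ℓ y m) (fun y => hopEig_nonneg ℓ y m)
  choose δ hδ0 hδ1 hδ2 using hsector
  refine (sq_le_sq₀ (norm_nonneg _) (Real.exp_pos _).le).1 ?_
  refine (norm_psiPQ_sub_psiPoly_sq_le hA hA0 p δ hδ0 hδ1).trans ?_
  refine (sum_norm_initS_sq_mul_le (e := fun m => ((1 + δ m) ^ T - 1) ^ 2) hℓ ha0
    (by positivity) hδ2).trans ?_
  have ha1 : (0 : ℝ) < (2 * D * T : ℕ) := by exact_mod_cast ha0
  have hbase : 6 * (3 + 2 * B) / R * (2 * (2 * D * T : ℕ) * Real.exp 1) = Real.exp (-1) := by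
    rw [← hR, Real.exp_neg]
    field_simp
  rw [hbase]
  linarith [tail_error_le haL, sq_nonneg (Real.exp (-L))]

/-- For `n = 0` the only mode is `0`, which is not queried, and for `T = 0` nothing is: the state
does not depend on the functions of positive arity. -/
lemma psiPQ_eq_psiPoly_of_trivial {n T ℓ w : ℕ} (h : n = 0 ∨ T = 0)
    {A : Matrix (RegA n w) (RegA n w) ℂ} (hA : A ∈ Matrix.unitaryGroup (RegA n w) ℂ)
    (hA0 : NeverQueriesZero T A) (p : Fin 2 → Polynomial ℝ) :
    psiPQ ℓ T A = psiPoly ℓ T A fun _ x => prodPoly p x := by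
  rw [← sub_eq_zero, ← norm_eq_zero, ← sq_eq_zero_iff]
  refine le_antisymm ?_ (sq_nonneg _)
  rcases h with rfl | rfl
  · refine (norm_psiPQ_sub_psiPoly_sq_le hA hA0 p 0 (fun _ => le_rfl)
      fun m y hy => absurd (Subsingleton.elim y 0) hy).trans ?_
    simp
  · refine (norm_psiPQ_sub_psiPoly_sq_le hA hA0 p
      (fun m => ∑ y, (|krausFun 0 (hopEig ℓ y m) - (p 0).eval (hopEig ℓ y m)|
        + |krausFun 1 (hopEig ℓ y m) - (p 1).eval (hopEig ℓ y m)|))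
      (fun m => by positivity) fun m y _ => ?_).trans ?_
    · exact Finset.single_le_sum (f := fun y =>
        |krausFun 0 (hopEig ℓ y m) - (p 0).eval (hopEig ℓ y m)|
        + |krausFun 1 (hopEig ℓ y m) - (p 1).eval (hopEig ℓ y m)|)
        (fun y _ => by positivity) (Finset.mem_univ y)
    · simp

end BosonOracle

end

theorem mainTheorem8 :
    ∃ C : ℝ, 0 < C ∧
      ∀ (n T : ℕ) (ι : ℝ), 0 < ι →
        ∃ AKraus : (k : ℕ) → (Fin k → Fin 2) → MvPolynomial (Fin k) ℝ,
          (∀ k ≤ T, ∀ x : Fin k → Fin 2,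
            ((AKraus k x).totalDegree : ℝ) ≤
              C * (n : ℝ) ^ 2 * (T : ℝ) ^ 5 * max 1 (Real.log T) *
                max 1 (Real.log (1 / ι)) ^ 2) ∧
          ∀ (ℓ : ℕ), 0 < ℓ →
            ∀ (w : ℕ) (A : Matrix (BosonOracle.RegA n w) (BosonOracle.RegA n w) ℂ),
              A ∈ Matrix.unitaryGroup (BosonOracle.RegA n w) ℂ →
              BosonOracle.NeverQueriesZero T A →
                ‖BosonOracle.psiPQ ℓ T A - BosonOracle.psiPoly ℓ T A AKraus‖ ≤ ι := by
  obtain ⟨c, hc, h⟩ := BosonOracle.exists_polynomials_norm_sub_le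
  refine ⟨c, hc, fun n T ι hι => ?_⟩
  by_cases htriv : n = 0 ∨ T = 0
  · refine ⟨fun _ x => BosonOracle.prodPoly 0 x, fun k _ x => ?_, fun ℓ _ w A hA hA0 => ?_⟩
    · have h0 := BosonOracle.totalDegree_prodPoly_le 0 (D := 0) (fun b => by simp) x
      rw [mul_zero, Nat.le_zero] at h0
      rw [h0, Nat.cast_zero]
      positivity
    · rw [BosonOracle.psiPQ_eq_psiPoly_of_trivial htriv hA hA0 0, sub_self, norm_zero]
      exact hι.le
  · push Not at htriv
    set L := max 1 (Real.log (1 / ι)) with hL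
    obtain ⟨p, hp, hp'⟩ := h n T L (Nat.pos_of_ne_zero htriv.1) (Nat.pos_of_ne_zero htriv.2)
      (le_max_left _ _)
    refine ⟨fun _ x => BosonOracle.prodPoly p x, fun k hk x => ?_, fun ℓ hℓ w A hA hA0 => ?_⟩
    · have hT1 : (1 : ℝ) ≤ T := by exact_mod_cast Nat.pos_of_ne_zero htriv.2
      obtain ⟨D, hD, hDc⟩ : ∃ D : ℕ, (∀ b, (p b).natDegree ≤ D) ∧
          (D : ℝ) ≤ c * ((n : ℝ) ^ 2 * (T : ℝ) ^ 3 * L ^ 2) := by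
        refine ⟨max (p 0).natDegree (p 1).natDegree, fun b => ?_, ?_⟩
        · fin_cases b
          · exact le_max_left _ _
          · exact le_max_right _ _
        · rw [Nat.cast_max]
          exact max_le (hp 0) (hp 1)
      have h1 := BosonOracle.totalDegree_prodPoly_le p hD x
      calc ((BosonOracle.prodPoly p x).totalDegree : ℝ) ≤ k * D := by exact_mod_cast h1
        _ ≤ T * (c * ((n : ℝ) ^ 2 * (T : ℝ) ^ 3 * L ^ 2)) := by gcongr
        _ = c * (n : ℝ) ^ 2 * (T : ℝ) ^ 4 * 1 * L ^ 2 := by ring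
        _ ≤ c * (n : ℝ) ^ 2 * (T : ℝ) ^ 5 * max 1 (Real.log T) * L ^ 2 := by
          gcongr
          · norm_num
          · exact le_max_left _ _
    · refine (hp' ℓ hℓ w A hA hA0).trans ?_
      calc Real.exp (-L) ≤ Real.exp (-Real.log (1 / ι)) :=
            Real.exp_le_exp.2 (neg_le_neg (le_max_right _ _))
        _ = ι := by rw [one_div, Real.log_inv, neg_neg, Real.exp_log hι]
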